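/- **Setting.** A *Polish group* is a topological group whose topology is separable and completely metrizable. A subset $S$ of a Polish group $G$ is *coarsely bounded* if it is bounded in every left-invariant metric on $G$ compatible with the topology; $G$ is a *coarsely bounded group* if it is a coarsely bounded subset of itself. For a generating set $S$ of $G$ let $\rho_S(x,y)=\min\{k\ge 0 : x^{-1}y\in(S\cup S^{-1})^k\}$. A map $\varphi:(X,d)\to(Y,d')$ is a *quasi-isometry* if there are $K\ge 1$, $C\ge 0$ with $K^{-1}d(x,x')-C\le d'(\varphi(x),\varphi(x'))\le K d(x,x')+C$ for all $x,x'\in X$ and such that every $y\in Y$ is within $d'$-distance $C$ of $\varphi(X)$. The group $G$ *has a well-defined quasi-isometry type* if it is generated by some closed coarsely bounded set and, for any two closed coarsely bounded generating sets $S,T$, the identity map $(G,\rho_S)\to(G,\rho_T)$ is a quasi-isometry. A metric $d$ on the set $G$ *represents the quasi-isometry type* of $G$ if the identity map $(G,d)\to(G,\rho_S)$ is a quasi-isometry for some closed coarsely bounded generating set $S$. A map $\varphi:G\to H$ between Polish groups is a *quasi-isometry of Polish groups* if $G$ and $H$ are both generated by coarsely bounded sets and $\varphi:(G,d_G)\to(H,d_H)$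 is a quasi-isometry whenever $d_G$, $d_H$ represent the quasi-isometry types of $G$, $H$. The quasi-isometry type of $G$ is *trivial* if there is a quasi-isometry of Polish groups from $G$ to the trivial group. Let $I=[0,1]$, let $\mathbb S^1$ be the circle of complex numbers of modulus one, and let $\pi:\mathbb R\to\mathbb S^1$, $\pi(x)=e^{2\pi i x}$. For a homeomorphism $f$ of $\mathbb S^1$ let $\tilde f$ be the unique homeomorphism of $\mathbb R$ with $\tilde f(0)\in[0,1)$ and $\pi\circ\tilde f=f\circ\pi$; $f$ is orientation-preserving if $\tilde f$ is increasing, and absolutely continuous if $\tilde f$ is absolutely continuous on every compact interval. Consider the following groups under composition. * $\mathrm{AC}_+(I)$: the increasing homeomorphisms $f:I\to I$ with $f$ and $f^{-1}$ absolutely continuous, with the topology of the metric $d_*(f,g)=\int_0^1|f'(t)-g'(t)|\,dt$. * $\mathrm{AC}_+(\mathbb S^1)$: the orientation-preserving homeomorphisms $f:\mathbb S^1\to\mathbb S^1$ with $f$ and $f^{-1}$ absolutely continuous, with the topology of the metric $\sup_{x\in\mathbb S^1}d_{\mathbb S^1}(f(x),g(x))+\int_0^1|\tilde f'(t)-\tilde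 g'(t)|\,dt$, where $d_{\mathbb S^1}(x,y)$ is the minimum distance in $\mathbb R$ between $\pi^{-1}(x)$ and $\pi^{-1}(y)$. * $\mathrm{AC}_{\mathbb Z}^{\mathrm{loc}}(\mathbb R)$: the homeomorphisms $f:\mathbb R\to\mathbb R$ with $f(x+n)=f(x)+n$ for all $x\in\mathbb R$, $n\in\mathbb Z$, and with $f$ and $f^{-1}$ absolutely continuous on every compact interval, with the topology of the metric $\sup_{x\in[0,1]}|f(x)-g(x)|+\int_0^1|f'(t)-g'(t)|\,dt$. **Theorem.** Each of $\mathrm{AC}_+(I)$, $\mathrm{AC}_+(\mathbb S^1)$ and $\mathrm{AC}_{\mathbb Z}^{\mathrm{loc}}(\mathbb R)$ is a Polish group, is generated by a coarsely bounded set, and has a well-defined quasi-isometry type. Both $\mathrm{AC}_+(I)$ and $\mathrm{AC}_+(\mathbb S^1)$ are coarsely bounded groups, and their quasi-isometry types are trivial. The map $\mathbb Z\to\mathrm{AC}_{\mathbb Z}^{\mathrm{loc}}(\mathbb R)$ sending $n$ to the translation $x\mapsto x+n$ is a quasi-isometry of Polish groups, where $\mathbb Z$ is discrete. -/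

import Mathlib

open Set MeasureTheory
open scoped Pointwise

noncomputable section

/-! ### Large-scale geometry of Polish groups -/

section LargeScale

/-- A Polish group: a topological group whose topology is Polish. -/
def IsPolishGroup (G : Type*) [Group G] [TopologicalSpace G] : Prop :=
  IsTopologicalGroup G ∧ PolishSpace G

/-- `S` is coarsely bounded in `G`: it is bounded in every left-invariant metric on `G` that is
compatible with the topology of `G`. -/
def IsCoarselyBounded {G : Type*} [Group G] [t : TopologicalSpace G] (S : Set G) : Prop :=
  ∀ m : MetricSpace G, m.toUniformSpace.toTopologicalSpace = t →
    (∀ g x y : G, m.dist (g * x) (g * y) = m.dist x y) →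
    ∃ C : ℝ, ∀ x ∈ S, ∀ y ∈ S, m.dist x y ≤ C

/-- `G` is a coarsely bounded group. -/
def IsCoarselyBoundedGroup (G : Type*) [Group G] [TopologicalSpace G] : Prop :=
  IsCoarselyBounded (univ : Set G)

/-- The word metric `ρ_S x y = min {k ≥ 0 | x⁻¹ y ∈ (S ∪ S⁻¹)ᵏ}`
(meaningful when `S` generates `G`). -/
def wordMetric {G : Type*} [Group G] (S : Set G) (x y : G) : ℝ :=
  ((sInf {k : ℕ | x⁻¹ * y ∈ (S ∪ S⁻¹) ^ k} : ℕ) : ℝ)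

/-- A quasi-isometry from `(X, d)` to `(Y, d')`: a quasi-isometric embedding that is
coarsely onto. -/
def IsQuasiIsometry {X Y : Type*} (d : X → X → ℝ) (d' : Y → Y → ℝ) (φ : X → Y) : Prop :=
  ∃ K : ℝ, 1 ≤ K ∧ ∃ C : ℝ, 0 ≤ C ∧
    (∀ x x' : X, K⁻¹ * d x x' - C ≤ d' (φ x) (φ x') ∧ d' (φ x) (φ x') ≤ K * d x x' + C) ∧
    ∀ y : Y, ∃ x : X, d' (φ x) y ≤ C

variable (G : Type*) [Group G] [TopologicalSpace G]

/-- `G` is generated by a coarsely bounded subset. -/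
def IsGeneratedByCoarselyBounded : Prop :=
  ∃ S : Set G, IsCoarselyBounded S ∧ Subgroup.closure S = ⊤

/-- The generating sets whose word metrics define the quasi-isometry type of `G`: those that are
closed and coarsely bounded. -/
def IsCoarseGeneratingSet {G : Type*} [Group G] [TopologicalSpace G] (S : Set G) : Prop :=
  IsClosed S ∧ IsCoarselyBounded S ∧ Subgroup.closure S = ⊤

/-- `G` has a well-defined quasi-isometry type: there is a closed coarsely bounded generating set,
and the word metrics of any two of them are quasi-isometric through the identity map. -/
def HasWellDefinedQIType : Prop :=
  (∃ S : Set G, IsCoarseGeneratingSet S) ∧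
    ∀ S T : Set G, IsCoarseGeneratingSet S → IsCoarseGeneratingSet T →
      IsQuasiIsometry (wordMetric S) (wordMetric T) (id : G → G)

/-- The metric `m` on (the set) `G` represents the quasi-isometry type of `G`: it is
quasi-isometric, through the identity map, to the word metric of some closed coarsely bounded
generating set. -/
def RepresentsQIType {G : Type*} [Group G] [TopologicalSpace G] (m : MetricSpace G) : Prop :=
  ∃ S : Set G, IsCoarseGeneratingSet S ∧ IsQuasiIsometry m.dist (wordMetric S) (id : G → G)

/-- `φ` is a quasi-isometry of Polish groups: both groups are Polish groups generated by coarsely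
bounded subsets, and `φ` is a quasi-isometry for all metrics that represent the quasi-isometry
types of the two groups. -/
def IsPolishQuasiIsometry {G H : Type*} [Group G] [TopologicalSpace G] [Group H]
    [TopologicalSpace H] (φ : G → H) : Prop :=
  IsPolishGroup G ∧ IsPolishGroup H ∧
  IsGeneratedByCoarselyBounded G ∧ IsGeneratedByCoarselyBounded H ∧
  ∀ (mG : MetricSpace G) (mH : MetricSpace H), RepresentsQIType mG → RepresentsQIType mH →
    IsQuasiIsometry mG.dist mH.dist φ

/-- The quasi-isometry type of `G` is trivial: `G` is quasi-isometric, as a Polish group, to the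
trivial group. -/
def HasTrivialQIType : Prop :=
  ∃ φ : G → Unit, IsPolishQuasiIsometry φ

end LargeScale

/-! ### Absolute continuity -/

/-- Local absolute continuity of a function on the line: absolute continuity on every compact
interval. -/
def LocallyAbsolutelyContinuous (f : ℝ → ℝ) : Prop :=
  ∀ a b : ℝ, AbsolutelyContinuousOnInterval f a b

theorem absolutelyContinuousOnInterval_comp_monotone {f g : ℝ → ℝ} {a b c d : ℝ}
    (hf : AbsolutelyContinuousOnInterval f c d) (hg : AbsolutelyContinuousOnInterval g a b)
    (hm : Monotone g) (hmap : ∀ x ∈ uIcc a b, g x ∈ uIcc c d) :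
    AbsolutelyContinuousOnInterval (fun x => f (g x)) a b := by
  rw [absolutelyContinuousOnInterval_iff] at *
  intro ε hε
  obtain ⟨δ, hδ, h1⟩ := hf ε hε
  obtain ⟨η, hη, h2⟩ := hg δ hδ
  refine ⟨η, hη, ?_⟩
  rintro ⟨n, I⟩ hE hlen
  refine h1 (n, fun i => (g (I i).1, g (I i).2)) ⟨?_, ?_⟩ (h2 _ hE hlen)
  · intro i hi
    exact ⟨hmap _ (hE.1 i hi).1, hmap _ (hE.1 i hi).2⟩
  · intro i hi j hj hij
    have h := hE.2 hi hj hij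
    simp only [Function.onFun, uIoc, Ioc_disjoint_Ioc] at h ⊢
    rw [← hm.map_min, ← hm.map_max, ← hm.map_min, ← hm.map_max, ← hm.map_min, ← hm.map_max]
    exact hm h

theorem LocallyAbsolutelyContinuous.comp_monotone {f g : ℝ → ℝ}
    (hf : LocallyAbsolutelyContinuous f) (hg : LocallyAbsolutelyContinuous g) (hm : Monotone g) :
    LocallyAbsolutelyContinuous (fun x => f (g x)) := by
  intro a b
  rcases le_total a b with hab | hab
  · refine absolutelyContinuousOnInterval_comp_monotone (hf (g a) (g b)) (hg a b) hm ?_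
    intro x hx
    rw [uIcc_of_le hab] at hx
    rw [uIcc_of_le (hm hab)]
    exact ⟨hm hx.1, hm hx.2⟩
  · refine absolutelyContinuousOnInterval_comp_monotone (hf (g a) (g b)) (hg a b) hm ?_
    intro x hx
    rw [uIcc_of_ge hab] at hx
    rw [uIcc_of_ge (hm hab)]
    exact ⟨hm hx.1, hm hx.2⟩

theorem lipschitz_locallyAbsolutelyContinuous {f : ℝ → ℝ} (hf : LipschitzWith 1 f) :
    LocallyAbsolutelyContinuous f :=
  fun _ _ => (hf.lipschitzOnWith (s := _)).absolutelyContinuousOnInterval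

/-- The quantity `∫₀¹ |f'(t) - g'(t)| dt`. -/
def derivDist (f g : ℝ → ℝ) : ℝ :=
  ∫ t in (0 : ℝ)..1, |deriv f t - deriv g t|

theorem derivDist_self (f : ℝ → ℝ) : derivDist f f = 0 := by
  simp [derivDist]

theorem derivDist_comm (f g : ℝ → ℝ) : derivDist f g = derivDist g f := by
  simp only [derivDist, abs_sub_comm]

theorem derivDist_triangle {f g h : ℝ → ℝ} (hf : AbsolutelyContinuousOnInterval f 0 1)
    (hg : AbsolutelyContinuousOnInterval g 0 1) (hh : AbsolutelyContinuousOnInterval h 0 1) :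
    derivDist f h ≤ derivDist f g + derivDist g h := by
  have if' := hf.intervalIntegrable_deriv
  have ig' := hg.intervalIntegrable_deriv
  have ih' := hh.intervalIntegrable_deriv
  unfold derivDist
  rw [← intervalIntegral.integral_add (if'.sub ig').abs (ig'.sub ih').abs]
  exact intervalIntegral.integral_mono_on zero_le_one (if'.sub ih').abs
    ((if'.sub ig').abs.add (ig'.sub ih').abs) (fun t _ => abs_sub_le _ _ _)

/-! ### The group of the interval -/

/-- A self-map of `[0,1]`, as a real function on the line, constant on each side of `[0,1]`. -/
def extendI (f : unitInterval ≃ₜ unitInterval) : ℝ → ℝ :=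
  IccExtend (zero_le_one : (0 : ℝ) ≤ 1) (fun x => (f x : ℝ))

theorem extendI_mul (f g : unitInterval ≃ₜ unitInterval) :
    extendI (f * g) = fun x => extendI f (extendI g x) := by
  funext x
  simp [extendI, IccExtend, projIcc_val]

theorem extendI_mem (f : unitInterval ≃ₜ unitInterval) (x : ℝ) :
    extendI f x ∈ uIcc (0 : ℝ) 1 := by
  rw [uIcc_of_le zero_le_one]
  exact (f _).2

theorem extendI_monotone {f : unitInterval ≃ₜ unitInterval} (hf : StrictMono f) :
    Monotone (extendI f) :=
  Monotone.IccExtend zero_le_one (fun _ _ h => hf.monotone h)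

/-- Absolute continuity of a homeomorphism of `[0,1]`. -/
def AbsolutelyContinuousI (f : unitInterval ≃ₜ unitInterval) : Prop :=
  AbsolutelyContinuousOnInterval (extendI f) 0 1

theorem AbsolutelyContinuousI.mul {f g : unitInterval ≃ₜ unitInterval}
    (hf : AbsolutelyContinuousI f) (hg : AbsolutelyContinuousI g) (hm : StrictMono g) :
    AbsolutelyContinuousI (f * g) := by
  unfold AbsolutelyContinuousI
  rw [extendI_mul]
  exact absolutelyContinuousOnInterval_comp_monotone hf hg (extendI_monotone hm)
    (fun x _ => extendI_mem g x)

theorem strictMono_inv {f : unitInterval ≃ₜ unitInterval} (hf : StrictMono f) :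
    StrictMono (f⁻¹ : unitInterval ≃ₜ unitInterval) := by
  intro x y hxy
  rw [← hf.lt_iff_lt]
  simpa using hxy

/-- `AC₊(I)`: the orientation-preserving homeomorphisms `f` of `[0,1]` such that `f` and `f⁻¹` are
absolutely continuous, as a group under composition. -/
def acISubgroup : Subgroup (unitInterval ≃ₜ unitInterval) where
  carrier := {f | StrictMono f ∧ AbsolutelyContinuousI f ∧ AbsolutelyContinuousI f⁻¹}
  one_mem' := by
    have h : AbsolutelyContinuousI 1 := by
      have : LipschitzWith 1 (extendI 1) := by
        have := (LipschitzWith.projIcc (zero_le_one : (0 : ℝ) ≤ 1))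
        exact fun x y => this x y
      exact lipschitz_locallyAbsolutelyContinuous this 0 1
    exact ⟨fun _ _ h => h, h, by simpa using h⟩
  mul_mem' := by
    rintro f g ⟨hf, hf1, hf2⟩ ⟨hg, hg1, hg2⟩
    refine ⟨hf.comp hg, hf1.mul hg1 hg, ?_⟩
    rw [mul_inv_rev]
    exact hg2.mul hf2 (strictMono_inv hf)
  inv_mem' := by
    rintro f ⟨hf, hf1, hf2⟩
    exact ⟨strictMono_inv hf, hf2, by simpa using hf1⟩

/-- The group `AC₊(I)`. -/
abbrev ACI : Type := acISubgroup

/-- `AC₊(I)` carries the topology of `d_*(f,g) = ∫₀¹ |f' - g'|`. -/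
instance : PseudoMetricSpace ACI where
  dist f g := derivDist (extendI f.1) (extendI g.1)
  dist_self f := derivDist_self _
  dist_comm f g := derivDist_comm _ _
  dist_triangle f g h := derivDist_triangle f.2.2.1 g.2.2.1 h.2.2.1

/-! ### The group of the line -/

theorem strictMono_of_add_intCast {f : ℝ ≃ₜ ℝ} (hf : ∀ (x : ℝ) (n : ℤ), f (x + n) = f x + n) :
    StrictMono f := by
  rcases f.continuous.strictMono_of_inj f.injective with h | h
  · exact h
  · have h1 := hf 0 1
    have h2 : f ((0 : ℝ) + ((1 : ℤ) : ℝ)) < f 0 := h (by norm_num)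
    rw [h1] at h2
    norm_num at h2

/-- `AC_ℤ^loc(ℝ)`: the homeomorphisms `f` of `ℝ` commuting with integer translations such that `f`
and `f⁻¹` are locally absolutely continuous, as a group under composition. -/
def acZSubgroup : Subgroup (ℝ ≃ₜ ℝ) where
  carrier := {f | (∀ (x : ℝ) (n : ℤ), f (x + n) = f x + n) ∧
    LocallyAbsolutelyContinuous f ∧ LocallyAbsolutelyContinuous (f⁻¹ : ℝ ≃ₜ ℝ)}
  one_mem' := by
    have h : LocallyAbsolutelyContinuous (1 : ℝ ≃ₜ ℝ) :=
      lipschitz_locallyAbsolutelyContinuous LipschitzWith.id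
    exact ⟨fun _ _ => rfl, h, by simpa using h⟩
  mul_mem' := by
    rintro f g ⟨hf, hf1, hf2⟩ ⟨hg, hg1, hg2⟩
    refine ⟨fun x n => by simp [hf, hg], ?_, ?_⟩
    · exact hf1.comp_monotone hg1 (strictMono_of_add_intCast hg).monotone
    · rw [mul_inv_rev]
      refine hg2.comp_monotone hf2 (strictMono_of_add_intCast (f := f⁻¹) ?_).monotone
      intro x n
      apply f.injective
      simp [hf]
  inv_mem' := by
    rintro f ⟨hf, hf1, hf2⟩
    refine ⟨fun x n => ?_, hf2, by simpa using hf1⟩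
    apply f.injective
    simp [hf]

/-- The group `AC_ℤ^loc(ℝ)`. -/
abbrev ACZLoc : Type := acZSubgroup

/-- `d_∞(f,g) = sup_{x ∈ [0,1]} |f x - g x|`. -/
def supDistI (f g : ℝ ≃ₜ ℝ) : ℝ :=
  ⨆ x : unitInterval, |f x - g x|

theorem supDistI_bddAbove (f g : ℝ ≃ₜ ℝ) :
    BddAbove (range fun x : unitInterval => |f x - g x|) :=
  (isCompact_range (by fun_prop)).bddAbove

theorem supDistI_triangle (f g h : ℝ ≃ₜ ℝ) : supDistI f h ≤ supDistI f g + supDistI g h :=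
  ciSup_le fun x => (abs_sub_le _ (g x) _).trans
    (add_le_add (le_ciSup (supDistI_bddAbove f g) x) (le_ciSup (supDistI_bddAbove g h) x))

/-- `AC_ℤ^loc(ℝ)` carries the topology of `d_∞ + d_*`, with `d_*(f,g) = ∫₀¹ |f' - g'|`. -/
instance : PseudoMetricSpace ACZLoc where
  dist f g := supDistI f.1 g.1 + derivDist f.1 g.1
  dist_self f := by simp [supDistI, derivDist_self]
  dist_comm f g := by
    rw [derivDist_comm]
    simp only [supDistI, abs_sub_comm]
  dist_triangle f g h := by
    have h1 := supDistI_triangle f.1 g.1 h.1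
    have h2 := derivDist_triangle (f.2.2.1 0 1) (g.2.2.1 0 1) (h.2.2.1 0 1)
    linarith

/-- The integer translation `τ_n : x ↦ x + n`, as an element of `AC_ℤ^loc(ℝ)`. -/
def integerTranslation (n : Multiplicative ℤ) : ACZLoc :=
  ⟨Homeomorph.addRight ((Multiplicative.toAdd n : ℤ) : ℝ), by
    refine ⟨fun x m => ?_, ?_, ?_⟩
    · simp [add_right_comm]
    · refine lipschitz_locallyAbsolutelyContinuous (LipschitzWith.of_dist_le_mul fun x y => ?_)
      simp
    · refine lipschitz_locallyAbsolutelyContinuous (LipschitzWith.of_dist_le_mul fun x y => ?_)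
      change dist (x + -_) (y + -_) ≤ _
      simp⟩

/-! ### The group of the circle -/

/-- The covering map `x ↦ e^{2πix}` from the line to the circle. -/
def circleCover (x : ℝ) : Circle := Circle.exp (2 * Real.pi * x)

theorem circleCover_eq_iff {x y : ℝ} : circleCover x = circleCover y ↔ ∃ m : ℤ, x = y + m := by
  unfold circleCover
  rw [Circle.exp_eq_exp]
  have hpi := Real.pi_pos
  refine exists_congr fun m => ⟨fun h => ?_, fun h => by rw [h]; ring⟩
  have : (2 * Real.pi) * x = (2 * Real.pi) * (y + m) := by rw [h]; ring
  exact mul_left_cancel₀ (by positivity) this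

theorem circleCover_exists (z : Circle) : ∃ x : ℝ, |x| ≤ 1 / 2 ∧ circleCover x = z := by
  have hpi := Real.pi_pos
  refine ⟨Complex.arg z / (2 * Real.pi), ?_, ?_⟩
  · rw [abs_div, abs_of_pos (show (0 : ℝ) < 2 * Real.pi by positivity), div_le_iff₀ (by positivity)]
    have := Complex.abs_arg_le_pi z
    linarith
  · unfold circleCover
    rw [mul_div_cancel₀ _ (by positivity)]
    exact Circle.exp_arg z

/-- The metric on the circle: the minimum distance between the fibres of the covering map. -/
def circleDist (x y : Circle) : ℝ :=
  sInf {r : ℝ | ∃ s t : ℝ, circleCover s = x ∧ circleCover t = y ∧ r = |s - t|}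

theorem circleDist_bddBelow (x y : Circle) :
    BddBelow {r : ℝ | ∃ s t : ℝ, circleCover s = x ∧ circleCover t = y ∧ r = |s - t|} :=
  ⟨0, by rintro r ⟨s, t, _, _, rfl⟩; exact abs_nonneg _⟩

theorem circleDist_nonempty (x y : Circle) :
    {r : ℝ | ∃ s t : ℝ, circleCover s = x ∧ circleCover t = y ∧ r = |s - t|}.Nonempty := by
  obtain ⟨s, _, hs⟩ := circleCover_exists x
  obtain ⟨t, _, ht⟩ := circleCover_exists y
  exact ⟨_, s, t, hs, ht, rfl⟩

theorem circleDist_nonneg (x y : Circle) : 0 ≤ circleDist x y :=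
  Real.sInf_nonneg (by rintro r ⟨s, t, _, _, rfl⟩; exact abs_nonneg _)

theorem circleDist_le_one (x y : Circle) : circleDist x y ≤ 1 := by
  obtain ⟨s, hs1, hs⟩ := circleCover_exists x
  obtain ⟨t, ht1, ht⟩ := circleCover_exists y
  refine (csInf_le (circleDist_bddBelow x y) ⟨s, t, hs, ht, rfl⟩).trans ?_
  have := abs_sub s t
  linarith

theorem circleDist_self (x : Circle) : circleDist x x = 0 := by
  refine le_antisymm ?_ (circleDist_nonneg x x)
  obtain ⟨s, _, hs⟩ := circleCover_exists x
  exact csInf_le (circleDist_bddBelow x x) ⟨s, s, hs, hs, by simp⟩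

theorem circleDist_comm (x y : Circle) : circleDist x y = circleDist y x := by
  unfold circleDist
  congr 1
  ext r
  constructor
  · rintro ⟨s, t, hs, ht, rfl⟩
    exact ⟨t, s, ht, hs, abs_sub_comm _ _⟩
  · rintro ⟨s, t, hs, ht, rfl⟩
    exact ⟨t, s, ht, hs, abs_sub_comm _ _⟩

theorem circleDist_triangle (x y z : Circle) :
    circleDist x z ≤ circleDist x y + circleDist y z := by
  refine le_of_forall_pos_le_add fun ε hε => ?_
  obtain ⟨_, ⟨s, t, hs, ht, rfl⟩, h1⟩ := exists_lt_of_csInf_lt (circleDist_nonempty x y)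
    (show circleDist x y < circleDist x y + ε / 2 by linarith)
  obtain ⟨_, ⟨t', u, ht', hu, rfl⟩, h2⟩ := exists_lt_of_csInf_lt (circleDist_nonempty y z)
    (show circleDist y z < circleDist y z + ε / 2 by linarith)
  obtain ⟨m, hm⟩ := circleCover_eq_iff.1 (ht'.trans ht.symm)
  have hu' : circleCover (u - m) = z := by
    rw [← hu]
    exact circleCover_eq_iff.2 ⟨-m, by push_cast; ring⟩
  have h3 : circleDist x z ≤ |s - (u - m)| :=
    csInf_le (circleDist_bddBelow x z) ⟨s, u - m, hs, hu', rfl⟩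
  have h4 : |s - (u - m)| ≤ |s - t| + |t' - u| := by
    have : s - (u - m) = (s - t) + (t' - u) := by rw [hm]; ring
    rw [this]
    exact abs_add_le _ _
  linarith

/-- `F` is the lift of the homeomorphism `f` of the circle: the homeomorphism of the line with
`F 0 ∈ [0,1)` that covers `f`. -/
def IsCircleLift (f : Circle ≃ₜ Circle) (F : ℝ ≃ₜ ℝ) : Prop :=
  F 0 ∈ Ico (0 : ℝ) 1 ∧ ∀ x : ℝ, circleCover (F x) = f (circleCover x)

theorem IsCircleLift.unique {f : Circle ≃ₜ Circle} {F G : ℝ ≃ₜ ℝ} (hF : IsCircleLift f F)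
    (hG : IsCircleLift f G) : F = G := by
  have h0 : F 0 = G 0 := by
    obtain ⟨m, hm⟩ := circleCover_eq_iff.1 ((hF.2 0).trans (hG.2 0).symm)
    have h1 := hF.1.1
    have h2 := hF.1.2
    have h3 := hG.1.1
    have h4 := hG.1.2
    have h5 : (m : ℝ) < 1 := by linarith
    have h6 : (-1 : ℝ) < m := by linarith
    have h7 : m < 1 := by exact_mod_cast h5
    have h8 : -1 < m := by exact_mod_cast h6
    have h9 : m = 0 := by omega
    rw [hm, h9]
    simp
  have key : (fun x => 2 * Real.pi * F x) = fun x => 2 * Real.pi * G x := by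
    refine Circle.isCoveringMap_exp.eq_of_comp_eq (by fun_prop) (by fun_prop) ?_ 0 ?_
    · funext x
      exact (hF.2 x).trans (hG.2 x).symm
    · simp [h0]
  ext x
  have := congrFun key x
  exact mul_left_cancel₀ (by have := Real.pi_pos; positivity) this

/-- A homeomorphism of the line covering `f` becomes the lift of `f` after an integer
translation. -/
theorem isCircleLift_sub_floor {f : Circle ≃ₜ Circle} {F : ℝ ≃ₜ ℝ}
    (hF : ∀ x : ℝ, circleCover (F x) = f (circleCover x)) :
    IsCircleLift f (F.trans (Homeomorph.addRight (-(⌊F 0⌋ : ℝ)))) := by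
  refine ⟨⟨?_, ?_⟩, fun x => ?_⟩
  · have := Int.floor_le (F 0)
    simp only [Homeomorph.trans_apply, Homeomorph.coe_addRight]
    linarith
  · have := Int.lt_floor_add_one (F 0)
    simp only [Homeomorph.trans_apply, Homeomorph.coe_addRight]
    linarith
  · rw [← hF x]
    exact circleCover_eq_iff.2 ⟨-⌊F 0⌋, by simp⟩

/-- `f` preserves the orientation of the circle: its lift is increasing. -/
def OrientationPreservingCircle (f : Circle ≃ₜ Circle) : Prop :=
  ∃ F : ℝ ≃ₜ ℝ, IsCircleLift f F ∧ StrictMono F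

/-- Absolute continuity of a homeomorphism of the circle: its lift is locally absolutely
continuous. -/
def AbsolutelyContinuousCircle (f : Circle ≃ₜ Circle) : Prop :=
  ∃ F : ℝ ≃ₜ ℝ, IsCircleLift f F ∧ LocallyAbsolutelyContinuous F

theorem OrientationPreservingCircle.mul {f g : Circle ≃ₜ Circle}
    (hf : OrientationPreservingCircle f) (hg : OrientationPreservingCircle g) :
    OrientationPreservingCircle (f * g) := by
  obtain ⟨F, hF, hF'⟩ := hf
  obtain ⟨G, hG, hG'⟩ := hg
  refine ⟨_, isCircleLift_sub_floor (f := f * g) (F := F * G) (fun x => ?_), ?_⟩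
  · simp [hF.2, hG.2]
  · intro x y hxy
    simpa using hF' (hG' hxy)

theorem OrientationPreservingCircle.inv {f : Circle ≃ₜ Circle}
    (hf : OrientationPreservingCircle f) : OrientationPreservingCircle f⁻¹ := by
  obtain ⟨F, hF, hF'⟩ := hf
  refine ⟨_, isCircleLift_sub_floor (f := f⁻¹) (F := F⁻¹) (fun x => ?_), ?_⟩
  · apply f.injective
    rw [← hF.2]
    simp
  · intro x y hxy
    have h : F⁻¹ x < F⁻¹ y := hF'.lt_iff_lt.1 (by simpa using hxy)
    simpa using h

theorem AbsolutelyContinuousCircle.mul {f g : Circle ≃ₜ Circle}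
    (hf : AbsolutelyContinuousCircle f) (hg : AbsolutelyContinuousCircle g)
    (hg' : OrientationPreservingCircle g) : AbsolutelyContinuousCircle (f * g) := by
  obtain ⟨F, hF, hF'⟩ := hf
  obtain ⟨G, hG, hG'⟩ := hg
  obtain ⟨G₁, hG₁, hm⟩ := hg'
  obtain rfl := hG.unique hG₁
  refine ⟨_, isCircleLift_sub_floor (f := f * g) (F := F * G) (fun x => ?_), ?_⟩
  · simp [hF.2, hG.2]
  · have h1 := hF'.comp_monotone hG' hm.monotone
    intro a b
    exact (h1 a b).add ((LipschitzWith.const _).lipschitzOnWith).absolutelyContinuousOnInterval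

/-- `AC₊(S¹)`: the orientation-preserving homeomorphisms `f` of the circle such that `f` and `f⁻¹`
are absolutely continuous, as a group under composition. -/
def acCircleSubgroup : Subgroup (Circle ≃ₜ Circle) where
  carrier := {f | OrientationPreservingCircle f ∧ AbsolutelyContinuousCircle f ∧
    AbsolutelyContinuousCircle f⁻¹}
  one_mem' := by
    have hl : IsCircleLift 1 1 := ⟨by simp, fun x => rfl⟩
    have h : AbsolutelyContinuousCircle 1 :=
      ⟨1, hl, lipschitz_locallyAbsolutelyContinuous LipschitzWith.id⟩
    exact ⟨⟨1, hl, fun _ _ h => h⟩, h, by simpa using h⟩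
  mul_mem' := by
    rintro f g ⟨hf, hf1, hf2⟩ ⟨hg, hg1, hg2⟩
    refine ⟨hf.mul hg, hf1.mul hg1 hg, ?_⟩
    rw [mul_inv_rev]
    exact hg2.mul hf2 hf.inv
  inv_mem' := by
    rintro f ⟨hf, hf1, hf2⟩
    exact ⟨hf.inv, hf2, by simpa using hf1⟩

/-- The group `AC₊(S¹)`. -/
abbrev ACCircle : Type := acCircleSubgroup

/-- The lift `f̃` of an element of `AC₊(S¹)`. -/
def circleLift (f : ACCircle) : ℝ ≃ₜ ℝ := f.2.1.choose

theorem circleLift_spec (f : ACCircle) : IsCircleLift f.1 (circleLift f) :=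
  f.2.1.choose_spec.1

theorem circleLift_locallyAbsolutelyContinuous (f : ACCircle) :
    LocallyAbsolutelyContinuous (circleLift f) := by
  obtain ⟨F, hF, hF'⟩ := f.2.2.1
  rwa [(circleLift_spec f).unique hF]

/-- `d_∞(f,g) = sup_{x ∈ S¹} d_{S¹}(f x, g x)`. -/
def supDistCircle (f g : Circle ≃ₜ Circle) : ℝ :=
  ⨆ x : Circle, circleDist (f x) (g x)

theorem supDistCircle_bddAbove (f g : Circle ≃ₜ Circle) :
    BddAbove (range fun x : Circle => circleDist (f x) (g x)) :=
  ⟨1, by rintro _ ⟨x, rfl⟩; exact circleDist_le_one _ _⟩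

theorem supDistCircle_triangle (f g h : Circle ≃ₜ Circle) :
    supDistCircle f h ≤ supDistCircle f g + supDistCircle g h :=
  ciSup_le fun x => (circleDist_triangle _ (g x) _).trans
    (add_le_add (le_ciSup (supDistCircle_bddAbove f g) x)
      (le_ciSup (supDistCircle_bddAbove g h) x))

/-- `AC₊(S¹)` carries the topology of `d_∞ + d_*`, with `d_*(f,g) = ∫₀¹ |f̃' - g̃'|`. -/
instance : PseudoMetricSpace ACCircle where
  dist f g := supDistCircle f.1 g.1 + derivDist (circleLift f) (circleLift g)
  dist_self f := by simp [supDistCircle, derivDist_self, circleDist_self]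
  dist_comm f g := by
    rw [derivDist_comm]
    simp only [supDistCircle, circleDist_comm]
  dist_triangle f g h := by
    have h1 := supDistCircle_triangle f.1 g.1 h.1
    have h2 := derivDist_triangle (circleLift_locallyAbsolutelyContinuous f 0 1)
      (circleLift_locallyAbsolutelyContinuous g 0 1) (circleLift_locallyAbsolutelyContinuous h 0 1)
    linarith

end

/-! The argument has an abstract half and an analytic half.

Abstractly, let `S` be a closed coarsely bounded generating set of a Polish group and put `U = S ∪
S⁻¹`. The powers of `U` are analytic and cover the group, so by Baire and Pettis some power is an
identity neighbourhood (`exists_pow_mem_nhds_one`). For a symmetric generating identity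
neighbourhood, charge a factorisation into its elements the length of each small factor and 1 for
each other factor. The least cost is a length function defining the topology
(`isCompatibleNorm_chainNorm`). A coarsely bounded set has bounded cost, and merging small factors
puts it inside a power of the neighbourhood. Hence coarsely bounded sets have bounded word length
(`IsPolishGroup.exists_subset_pow`), all admissible word metrics are Lipschitz equivalent, and a
quasi-isometry need only be checked for one pair of them.

Analytically, the work takes place in `ACZLoc`. Its metric is right-invariant by change of
variables, and left translations are continuous because `f'` can be approximated in `L¹` by
continuous functions. The data `f(0)`, `f'` and the same data for `f⁻¹` embed the group as a closed
subset of a Polish space. The linear path from the identity to `f` has speed at most `|f(0)| + 4`,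
so by right-invariance `f` is a product of `n` factors near 1, with `n` depending only on a bound
for `|f(0)|`. Therefore the set of `f` with `|f(0)| ≤ 1` is coarsely bounded, and it generates. Its
elements move no point by more than 2, which bounds the word length of the translation by `n` below
by `|n| / 2`.

`ACI` is the closed subgroup fixing 0, and the linear paths stay inside it. `ACCircle` is a
continuous open image of `ACZLoc`, and each of its elements has a lift with `|f(0)| ≤ 1 / 2`. Both
groups are therefore coarsely bounded. -/

open Filter Topology

noncomputable section

/-! ### Baire category: analytic sets and Pettis' lemma -/

section BaireCategory

variable {X : Type*} [TopologicalSpace X]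

/-- The points at which `A` is locally nonmeagre. -/
def nonmeagreKernel (A : Set X) : Set X :=
  {x | ∀ U ∈ 𝓝 x, ¬ IsMeagre (A ∩ U)}

theorem isClosed_nonmeagreKernel (A : Set X) : IsClosed (nonmeagreKernel A) := by
  rw [← isOpen_compl_iff, isOpen_iff_mem_nhds]
  intro x hx
  simp only [nonmeagreKernel, mem_compl_iff, mem_ofPred_eq, not_forall, not_not] at hx
  obtain ⟨U, hU, hm⟩ := hx
  filter_upwards [eventually_mem_nhds_iff.2 hU] with y hy h
  exact h U hy hm

/-- Each point of the difference has a basic open neighbourhood on which `A` is meagre, and there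
are only countably many basic open sets. -/
theorem isMeagre_diff_nonmeagreKernel [SecondCountableTopology X] (A : Set X) :
    IsMeagre (A \ nonmeagreKernel A) := by
  have hb := TopologicalSpace.isBasis_countableBasis X
  have hc := (TopologicalSpace.countable_countableBasis X).to_subtype
  have : IsMeagre (⋃ U : TopologicalSpace.countableBasis X,
      ⋃ _ : IsMeagre (A ∩ (U : Set X)), A ∩ (U : Set X)) := by
    refine isMeagre_iUnion fun U => ?_
    by_cases h : IsMeagre (A ∩ (U : Set X))
    · simp only [h, iUnion_true]
    · simp [h, IsMeagre.empty]
  refine this.mono ?_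
  rintro x ⟨hxA, hx⟩
  simp only [nonmeagreKernel, mem_ofPred_eq, not_forall, not_not] at hx
  obtain ⟨U, hU, hm⟩ := hx
  obtain ⟨V, hV, hxV, hVU⟩ := hb.mem_nhds_iff.1 hU
  simp only [mem_iUnion]
  exact ⟨⟨V, hV⟩, hm.mono (inter_subset_inter_right _ hVU), hxA, hxV⟩

/-- The difference `Z` is built from closed sets, so it equals an open set `u` modulo a meagre set.
Since `A` is covered by the `B n`, `A ∩ Z` is meagre, hence so is `A ∩ u`. Thus `u` misses the
kernel of `A`, so `Z` is disjoint from `u` and must be meagre. -/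
theorem isMeagre_nonmeagreKernel_diff_iUnion [SecondCountableTopology X] {A : Set X}
    {B : ℕ → Set X} (h : A ⊆ ⋃ n, B n) :
    IsMeagre (nonmeagreKernel A \ ⋃ n, nonmeagreKernel (B n)) := by
  set Z := nonmeagreKernel A \ ⋃ n, nonmeagreKernel (B n) with hZ
  have hbm : BaireMeasurableSet Z := by
    refine BaireMeasurableSet.diff ?_ (BaireMeasurableSet.iUnion fun n => ?_)
    · exact (isClosed_nonmeagreKernel A).isOpen_compl.baireMeasurableSet.of_compl
    · exact (isClosed_nonmeagreKernel _).isOpen_compl.baireMeasurableSet.of_compl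
  obtain ⟨u, huo, hu⟩ := hbm.residualEq_isOpen
  have h1 : IsMeagre (Z \ u) := by
    filter_upwards [hu] with x hx hx'
    exact hx'.2 (hx.mp hx'.1)
  have h2 : IsMeagre (u \ Z) := by
    filter_upwards [hu] with x hx hx'
    exact hx'.2 (hx.mpr hx'.1)
  have h3 : IsMeagre (A ∩ Z) := by
    refine (isMeagre_iUnion fun n => isMeagre_diff_nonmeagreKernel (B n)).mono ?_
    rintro x ⟨hxA, hxZ⟩
    obtain ⟨n, hn⟩ := mem_iUnion.1 (h hxA)
    exact mem_iUnion.2 ⟨n, hn, fun hx => hxZ.2 (mem_iUnion.2 ⟨n, hx⟩)⟩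
  have hZu : ∀ x ∈ Z, x ∉ u := by
    intro x hx hxu
    refine hx.1 u (huo.mem_nhds hxu) ?_
    refine (h2.union h3).mono ?_
    rintro y ⟨hyA, hyu⟩
    by_cases hy : y ∈ Z
    · exact Or.inr ⟨hyA, hy⟩
    · exact Or.inl ⟨hyu, hy⟩
  have hsub : Z ⊆ Z \ u := fun x hx => ⟨hx, hZu x hx⟩
  exact h1.mono hsub

/-- An analytic set coincides with a closed set up to a meagre set. -/
theorem MeasureTheory.AnalyticSet.isMeagre_nonmeagreKernel_diff [SecondCountableTopology X]
    [T2Space X] {A : Set X} (hA : AnalyticSet A) : IsMeagre (nonmeagreKernel A \ A) := by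
  rw [AnalyticSet] at hA
  rcases hA with rfl | ⟨f, hf, rfl⟩
  · refine IsMeagre.mono (fun x hx => ?_) IsMeagre.empty
    have h := hx.1 univ univ_mem
    rw [empty_inter] at h
    exact absurd IsMeagre.empty h
  -- A Souslin scheme for the range of `f`. `PiNat.res` lists the initial values of a sequence in
  -- reverse order, so `n :: s` extends the finite sequence `s` by one value.
  let P : List ℕ → Set X := fun s => f '' {x | PiNat.res x s.length = s}
  have hP : ∀ s, P s ⊆ ⋃ n, P (n :: s) := by
    rintro s _ ⟨x, hx, rfl⟩
    refine mem_iUnion.2 ⟨x s.length, x, ?_, rfl⟩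
    simpa [PiNat.res_succ] using hx
  have hP0 : P [] = range f := by simp [P]
  refine (isMeagre_iUnion fun s => isMeagre_nonmeagreKernel_diff_iUnion (hP s)).mono ?_
  rintro x ⟨hx, hxf⟩
  by_contra hcon
  simp only [mem_iUnion, Set.mem_sdiff, not_exists, not_and, not_forall, not_not] at hcon
  -- Off the countably many exceptional sets, membership in a kernel passes to some child in the
  -- scheme. Iterating produces a branch `y`.
  have step : ∀ s : {s // x ∈ nonmeagreKernel (P s)}, ∃ n, x ∈ nonmeagreKernel (P (n :: s.1)) :=
    fun s => hcon s.1 s.2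
  choose g hg using step
  let br : ℕ → {s // x ∈ nonmeagreKernel (P s)} := fun k =>
    Nat.rec ⟨[], by rw [hP0]; exact hx⟩ (fun _ s => ⟨g s :: s.1, hg s⟩) k
  let y : ℕ → ℕ := fun k => g (br k)
  have hbr : ∀ k, PiNat.res y k = (br k).1 := by
    intro k
    induction k with
    | zero => simp [br]
    | succ k ih => rw [PiNat.res_succ, ih]
  -- If `f y ≠ x`, continuity sends a cylinder around `y` away from a neighbourhood of `x`, although
  -- the image of that cylinder is nonmeagre near `x`.
  have hne : f y ≠ x := fun h => hxf ⟨y, h⟩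
  obtain ⟨U, V, hU, hV, hyU, hxV, hUV⟩ := t2_separation hne
  have hmem : f ⁻¹' U ∈ 𝓝 y := hf.continuousAt.preimage_mem_nhds (hU.mem_nhds hyU)
  obtain ⟨_, ⟨z, k, rfl⟩, hyC, hCU⟩ :=
    (PiNat.isTopologicalBasis_cylinders (fun _ : ℕ => ℕ)).mem_nhds_iff.1 hmem
  rw [← PiNat.mem_cylinder_iff_eq.1 hyC] at hCU
  refine (br k).2 V (hV.mem_nhds hxV) ?_
  have : P (br k).1 ∩ V = ∅ := by
    refine eq_empty_of_forall_notMem ?_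
    rintro _ ⟨⟨w, hw, rfl⟩, hwV⟩
    refine disjoint_left.1 hUV (hCU ?_) hwV
    rw [PiNat.cylinder_eq_res]
    have hl : (br k).1.length = k := by rw [← hbr k, PiNat.res_length]
    simp only [mem_ofPred_eq, hl] at hw ⊢
    rw [hw, hbr]
  rw [this]
  exact IsMeagre.empty

/-- Pettis' lemma for analytic sets. -/
theorem MeasureTheory.AnalyticSet.mul_inv_mem_nhds_one {G : Type*} [Group G] [TopologicalSpace G]
    [IsTopologicalGroup G] [PolishSpace G] {A : Set G} (hA : AnalyticSet A) (hm : ¬ IsMeagre A) :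
    A * A⁻¹ ∈ 𝓝 (1 : G) := by
  have hE := isMeagre_diff_nonmeagreKernel A
  have hE' := hA.isMeagre_nonmeagreKernel_diff
  set E := nonmeagreKernel A with hEdef
  have hEc : IsClosed E := isClosed_nonmeagreKernel A
  have hne : (interior E).Nonempty := by
    by_contra h
    rw [not_nonempty_iff_eq_empty] at h
    have : IsMeagre E := (hEc.isNowhereDense_iff.2 h).isMeagre
    refine hm ((this.union hE).mono fun x hx => ?_)
    by_cases hxE : x ∈ E
    · exact Or.inl hxE
    · exact Or.inr ⟨hx, hxE⟩
  obtain ⟨p, hp⟩ := hne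
  have hnhds : {g : G | g * p ∈ interior E} ∈ 𝓝 (1 : G) := by
    have hc : ContinuousAt (fun g : G => g * p) 1 := by fun_prop
    exact hc.preimage_mem_nhds (isOpen_interior.mem_nhds (by simpa using hp))
  refine mem_of_superset hnhds fun g hg => ?_
  -- For `g` near 1 the interior of `E` meets its translate by `g` in a nonempty open set. Removing
  -- `E \ A` and its translate leaves a point `x` of `A ∩ gA`, and `g = x (g⁻¹ x)⁻¹`.
  have hopen : IsOpen (interior E ∩ (fun x => g⁻¹ * x) ⁻¹' interior E) :=
    isOpen_interior.inter (isOpen_interior.preimage (by fun_prop))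
  have hn := not_isMeagre_of_isOpen hopen ⟨g * p, hg, by simpa using hp⟩
  have hmg : IsMeagre ((fun x => g⁻¹ * x) ⁻¹' (E \ A)) :=
    hE'.preimage_of_isOpenMap (by fun_prop) (isOpenMap_mul_left g⁻¹)
  obtain ⟨x, ⟨hx1, hx2⟩, hx3⟩ : ((interior E ∩ (fun x => g⁻¹ * x) ⁻¹' interior E) \
      ((E \ A) ∪ (fun x => g⁻¹ * x) ⁻¹' (E \ A))).Nonempty := by
    rw [sdiff_nonempty]
    exact fun h => hn ((hE'.union hmg).mono h)
  simp only [mem_union, Set.mem_sdiff, mem_preimage, not_or, not_and, not_not] at hx3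
  refine mem_mul.2 ⟨x, hx3.1 (interior_subset hx1), (g⁻¹ * x)⁻¹, ?_, by group⟩
  exact inv_mem_inv.2 (hx3.2 (interior_subset hx2))

/-- Powers of a closed set need not be closed, but they are continuous images of analytic sets. As
they cover the group, one of them, `U ^ n`, is nonmeagre, and by symmetry Pettis' lemma concerns `U
^ (n + n)`. -/
theorem exists_pow_mem_nhds_one {G : Type*} [Group G] [TopologicalSpace G]
    [IsTopologicalGroup G] [PolishSpace G] {U : Set G} (hU : IsClosed U) (hinv : U⁻¹ = U)
    (hgen : ∀ g, ∃ n : ℕ, g ∈ U ^ n) : ∃ n : ℕ, U ^ n ∈ 𝓝 (1 : G) := by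
  have han : ∀ n : ℕ, AnalyticSet (U ^ n) := by
    intro n
    induction n with
    | zero => rw [pow_zero]; exact (isClosed_singleton (x := (1 : G))).analyticSet
    | succ n ih =>
      rw [pow_succ, ← image_mul_prod]
      refine AnalyticSet.image_of_continuous ?_ continuous_mul
      have h1 := ih.preimage (X := G × G) (f := Prod.fst) continuous_fst
      have h2 := (hU.preimage (continuous_snd (X := G) (Y := G))).analyticSet
      rw [Set.prod_eq, inter_eq_iInter]
      exact AnalyticSet.iInter fun b => by cases b <;> assumption
  by_contra! hcon
  have hmea : ∀ n, IsMeagre (U ^ n) := by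
    intro n
    by_contra h
    refine hcon (n + n) ?_
    have := (han n).mul_inv_mem_nhds_one h
    rwa [← inv_pow, hinv, ← pow_add] at this
  refine not_isMeagre_of_isOpen (isOpen_univ (X := G)) univ_nonempty
    ((isMeagre_iUnion hmea).mono fun g _ => ?_)
  exact mem_iUnion.2 (hgen g)

end BaireCategory

/-! ### Length functions and coarsely bounded sets -/

section CompatibleNorm

variable {G : Type*} [Group G]

/-- A length function on a group that defines its topology. -/
structure IsCompatibleNorm [TopologicalSpace G] (N : G → ℝ) : Prop where
  one : N 1 = 0
  inv : ∀ g, N g⁻¹ = N g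
  mul_le : ∀ g h, N (g * h) ≤ N g + N h
  basis : (𝓝 (1 : G)).HasBasis (fun ε : ℝ => 0 < ε) fun ε => {g | N g < ε}

theorem IsCompatibleNorm.nonneg [TopologicalSpace G] {N : G → ℝ} (hN : IsCompatibleNorm N)
    (g : G) : 0 ≤ N g := by
  have h := hN.mul_le g g⁻¹
  rw [mul_inv_cancel, hN.one, hN.inv] at h
  linarith

/-- Coarsely bounded sets are bounded for every length function defining the topology. -/
theorem IsCoarselyBounded.exists_norm_le [t : TopologicalSpace G] [IsTopologicalGroup G]
    [T1Space G] {S : Set G} (hS : IsCoarselyBounded S) {N : G → ℝ} (hN : IsCompatibleNorm N) :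
    ∃ C, ∀ g ∈ S, N g ≤ C := by
  -- A length function gives the left-invariant distance `N (x⁻¹ * y)`, to which coarse boundedness
  -- applies.
  let p : PseudoMetricSpace G :=
    { dist := fun x y => N (x⁻¹ * y)
      dist_self := fun x => by simp [hN.one]
      dist_comm := fun x y => by
        rw [← hN.inv]
        simp
      dist_triangle := fun x y z => by
        have : x⁻¹ * z = (x⁻¹ * y) * (y⁻¹ * z) := by group
        rw [this]
        exact hN.mul_le _ _ }
  let m : MetricSpace G :=
    { p with
      eq_of_dist_eq_zero := by
        intro x y hxy
        by_contra hne
        have h1 : ({x⁻¹ * y}ᶜ : Set G) ∈ 𝓝 (1 : G) := by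
          refine isOpen_compl_singleton.mem_nhds ?_
          intro h
          exact hne (inv_mul_eq_one.1 (mem_singleton_iff.1 h).symm)
        obtain ⟨ε, hε, hs⟩ := hN.basis.mem_iff.1 h1
        refine hs (show x⁻¹ * y ∈ _ from ?_) rfl
        change N (x⁻¹ * y) < ε
        have : N (x⁻¹ * y) = 0 := hxy
        rwa [this] }
  have hm : m.toUniformSpace.toTopologicalSpace = t := by
    refine TopologicalSpace.ext_nhds fun x => ?_
    have h1 := @Metric.nhds_basis_ball G p x
    have h2 : (@nhds G t x).HasBasis (fun ε : ℝ => 0 < ε) fun ε => {g | N (x⁻¹ * g) < ε} := by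
      rw [← map_mul_left_nhds_one x]
      refine (hN.basis.map _).to_hasBasis ?_ ?_
      · intro ε hε
        refine ⟨ε, hε, fun g hg => ⟨x⁻¹ * g, hg, by group⟩⟩
      · intro ε hε
        refine ⟨ε, hε, ?_⟩
        rintro _ ⟨g, hg, rfl⟩
        simpa using hg
    have h3 : @Metric.ball G p x = fun ε => {g | N (x⁻¹ * g) < ε} := by
      funext ε
      ext g
      rw [@Metric.mem_ball']
      rfl
    rw [h3] at h1
    exact h1.eq_of_same_basis h2
  obtain ⟨C, hC⟩ := hS m hm (fun g x y => by
    change N ((g * x)⁻¹ * (g * y)) = N (x⁻¹ * y)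
    congr 1
    group)
  rcases S.eq_empty_or_nonempty with rfl | ⟨x, hx⟩
  · exact ⟨0, fun _ h => absurd h (notMem_empty _)⟩
  · refine ⟨N x + C, fun g hg => ?_⟩
    have h1 : N (x⁻¹ * g) ≤ C := hC x hx g hg
    have h2 := hN.mul_le x (x⁻¹ * g)
    rw [mul_inv_cancel_left] at h2
    linarith

/-- A right-invariant pseudometric defining the topology gives a compatible length function. -/
theorem isCompatibleNorm_dist_one [PseudoMetricSpace G]
    (h : ∀ f g k : G, dist (f * k) (g * k) = dist f g) :
    IsCompatibleNorm fun g : G => dist g 1 where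
  one := dist_self _
  inv g := by rw [← h g⁻¹ 1 g, inv_mul_cancel, one_mul, dist_comm]
  mul_le f g := by
    refine (dist_triangle (f * g) g 1).trans ?_
    have := h f 1 g
    rw [one_mul] at this
    rw [this]
  basis := Metric.nhds_basis_ball

/-- A set contained in a power of every identity neighbourhood is coarsely bounded. -/
theorem isCoarselyBounded_of_forall_subset_pow [t : TopologicalSpace G] {S : Set G}
    (hS : ∀ V ∈ 𝓝 (1 : G), ∃ k : ℕ, S ⊆ V ^ k) : IsCoarselyBounded S := by
  intro m hm hinv
  subst hm
  obtain ⟨k, hk⟩ := hS (Metric.ball 1 1) (Metric.ball_mem_nhds _ one_pos)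
  have key : ∀ n : ℕ, ∀ g ∈ (Metric.ball (1 : G) 1) ^ n, dist 1 g ≤ n := by
    intro n
    induction n with
    | zero =>
      intro g hg
      rw [pow_zero, Set.mem_one] at hg
      simp [hg]
    | succ n ih =>
      intro g hg
      rw [pow_succ] at hg
      obtain ⟨a, ha, b, hb, rfl⟩ := mem_mul.1 hg
      have h1 := ih a ha
      have h2 : dist (a * 1) (a * b) = dist 1 b := hinv a 1 b
      rw [mul_one] at h2
      have h3 := Metric.mem_ball'.1 hb
      have h4 := dist_triangle 1 a (a * b)
      rw [dist_comm] at h3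
      rw [dist_comm b 1] at h3
      push_cast
      linarith
  refine ⟨k + k, fun x hx y hy => ?_⟩
  have h1 := key k x (hk hx)
  have h2 := key k y (hk hy)
  have h3 := dist_triangle x 1 y
  rw [dist_comm] at h1
  change dist x y ≤ _
  linarith

/-- Cost of a step `g`, given a length function `N` and a threshold `ε`. -/
def stepCost (N : G → ℝ) (ε : ℝ) (g : G) : ℝ :=
  open Classical in if N g < ε then N g else 1

/-- Minimal cost of a factorisation of `g` into elements of `U`. -/
def chainNorm (N : G → ℝ) (ε : ℝ) (U : Set G) (g : G) : ℝ :=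
  sInf {s | ∃ L : List G, (∀ x ∈ L, x ∈ U) ∧ L.prod = g ∧ (L.map (stepCost N ε)).sum = s}

theorem exists_list_chainNorm_lt {N : G → ℝ} {ε : ℝ} {U : Set G}
    (hgen : ∀ g, ∃ n : ℕ, g ∈ U ^ n) (g : G) {r : ℝ}
    (hr : chainNorm N ε U g < r) :
    ∃ L : List G, (∀ x ∈ L, x ∈ U) ∧ L.prod = g ∧ (L.map (stepCost N ε)).sum < r := by
  have hne : {s | ∃ L : List G, (∀ x ∈ L, x ∈ U) ∧ L.prod = g ∧
      (L.map (stepCost N ε)).sum = s}.Nonempty := by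
    obtain ⟨n, hn⟩ := hgen g
    obtain ⟨f, hf⟩ := mem_pow.1 hn
    exact ⟨_, List.ofFn fun i => (f i : G), by simp [List.mem_ofFn], hf, rfl⟩
  obtain ⟨_, ⟨L, h1, h2, rfl⟩, h3⟩ := exists_lt_of_csInf_lt hne hr
  exact ⟨L, h1, h2, h3⟩

section ChainNorm

variable [TopologicalSpace G] {N : G → ℝ} {ε : ℝ} {U : Set G}

theorem stepCost_nonneg (hN : IsCompatibleNorm N) (g : G) : 0 ≤ stepCost N ε g := by
  unfold stepCost
  split_ifs
  · exact hN.nonneg g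
  · exact zero_le_one

theorem sum_stepCost_nonneg (hN : IsCompatibleNorm N) (L : List G) :
    0 ≤ (L.map (stepCost N ε)).sum := by
  refine List.sum_nonneg ?_
  simp only [List.mem_map]
  rintro _ ⟨x, _, rfl⟩
  exact stepCost_nonneg hN x

theorem chainNorm_le (hN : IsCompatibleNorm N) {L : List G} (hL : ∀ x ∈ L, x ∈ U) :
    chainNorm N ε U L.prod ≤ (L.map (stepCost N ε)).sum := by
  refine csInf_le ⟨0, ?_⟩ ⟨L, hL, rfl, rfl⟩
  rintro _ ⟨L, _, _, rfl⟩
  exact sum_stepCost_nonneg hN L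

/-- A step that is not small costs `1 ≥ ε`, so a chain of cost below `ε` has small steps only; these
are charged their true length and `N` is subadditive. -/
theorem norm_prod_le_sum_stepCost (hN : IsCompatibleNorm N) (hε : ε ≤ 1) :
    ∀ L : List G, (L.map (stepCost N ε)).sum < ε → N L.prod ≤ (L.map (stepCost N ε)).sum
  | [], _ => by simp [hN.one]
  | a :: L, h => by
    simp only [List.map_cons, List.sum_cons, List.prod_cons] at h ⊢
    have h0 := sum_stepCost_nonneg (ε := ε) hN L
    have h1 := stepCost_nonneg (ε := ε) hN a
    have ih := norm_prod_le_sum_stepCost hN hε L (by linarith)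
    have ha : stepCost N ε a = N a := by
      by_contra hne
      have : stepCost N ε a = 1 := by
        unfold stepCost at hne ⊢
        split_ifs at hne ⊢
        · exact absurd rfl hne
        · rfl
      linarith
    have := hN.mul_le a L.prod
    linarith

/-- Below `ε` the chain norm and `N` have the same balls, so they define the same topology. At large
scale the chain norm behaves like word length in `U`, which is what makes it useful. -/
theorem isCompatibleNorm_chainNorm (hN : IsCompatibleNorm N) (hε : 0 < ε) (hε1 : ε ≤ 1)
    (hgen : ∀ g, ∃ n : ℕ, g ∈ U ^ n) (hinv : ∀ g ∈ U, g⁻¹ ∈ U) (hsub : {g | N g < ε} ⊆ U) :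
    IsCompatibleNorm (chainNorm N ε U) := by
  have hcost : ∀ g, stepCost N ε g⁻¹ = stepCost N ε g := fun g => by simp [stepCost, hN.inv]
  have hnn : ∀ g, 0 ≤ chainNorm N ε U g := by
    intro g
    refine Real.sInf_nonneg ?_
    rintro _ ⟨L, _, _, rfl⟩
    exact sum_stepCost_nonneg hN L
  -- Inverting and reversing a chain preserves its cost.
  have hle : ∀ g, chainNorm N ε U g⁻¹ ≤ chainNorm N ε U g := by
    intro g
    refine le_of_forall_gt_imp_ge_of_dense fun r hr => ?_
    obtain ⟨L, h1, rfl, h3⟩ := exists_list_chainNorm_lt hgen g hr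
    have h4 := chainNorm_le (ε := ε) (L := (L.map (·⁻¹)).reverse) hN (U := U) (by
      simp only [List.mem_reverse, List.mem_map]
      rintro _ ⟨x, hx, rfl⟩
      exact hinv x (h1 x hx))
    rw [← List.prod_inv_reverse, List.map_reverse, List.sum_reverse, List.map_map] at h4
    have : stepCost N ε ∘ (·⁻¹) = stepCost N ε := funext hcost
    rw [this] at h4
    exact h4.trans h3.le
  have hsmall : ∀ g, N g < ε → chainNorm N ε U g ≤ N g := by
    intro g hg
    have := chainNorm_le (ε := ε) (L := [g]) hN (U := U) (by simpa using hsub hg)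
    simpa [stepCost, hg] using this
  have hbig : ∀ g, ∀ r ≤ ε, chainNorm N ε U g < r → N g < r := by
    intro g r hr h
    obtain ⟨L, h1, rfl, h3⟩ := exists_list_chainNorm_lt hgen g h
    exact (norm_prod_le_sum_stepCost hN hε1 L (h3.trans_le hr)).trans_lt h3
  refine ⟨le_antisymm ?_ (hnn 1), fun g => le_antisymm (hle g) ?_, fun g h => ?_, ?_⟩
  · simpa using chainNorm_le (ε := ε) (L := []) hN (U := U) (by simp)
  · simpa using hle g⁻¹
  · refine le_of_forall_pos_le_add fun δ hδ => ?_
    obtain ⟨L, h1, hL, h3⟩ := exists_list_chainNorm_lt hgen g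
      (show chainNorm N ε U g < chainNorm N ε U g + δ / 2 by linarith)
    obtain ⟨L', h1', hL', h3'⟩ := exists_list_chainNorm_lt hgen h
      (show chainNorm N ε U h < chainNorm N ε U h + δ / 2 by linarith)
    have := chainNorm_le (ε := ε) (L := L ++ L') hN (U := U) (by
      simp only [List.mem_append]
      rintro x (hx | hx)
      exacts [h1 x hx, h1' x hx])
    simp only [List.prod_append, List.map_append, List.sum_append, hL, hL'] at this
    linarith
  · refine hN.basis.to_hasBasis ?_ ?_
    · intro δ hδ
      refine ⟨min δ ε, lt_min hδ hε, fun g hg => ?_⟩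
      exact (hbig g _ (min_le_right _ _) hg).trans_le (min_le_left _ _)
    · intro δ hδ
      refine ⟨min δ ε, lt_min hδ hε, fun g hg => ?_⟩
      have hg' : N g < min δ ε := hg
      exact (hsmall g (hg'.trans_le (min_le_right _ _))).trans_lt
        (hg'.trans_le (min_le_left _ _))

/-- A chain of small cost can be shortened by merging consecutive small steps. -/
theorem exists_pow_mul_of_sum_stepCost (hN : IsCompatibleNorm N) (hε : 0 < ε) (hε1 : ε ≤ 1)
    (hsub : {g | N g < ε} ⊆ U) (L : List G) : (∀ x ∈ L, x ∈ U) →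
    ∃ k : ℕ, ∃ u ∈ (insert 1 U) ^ k, ∃ v, N v < ε ∧ L.prod = u * v ∧
      k * ε + N v ≤ 2 * (L.map (stepCost N ε)).sum := by
  -- Steps are added on the right. The remainder `v` collects small steps not yet counted among the
  -- `k` letters, and the factor 2 pays for closing a letter when the remainder overflows.
  induction L using List.reverseRecOn with
  | nil => exact fun _ => ⟨0, 1, by simp, 1, by rw [hN.one]; exact hε, by simp, by simp [hN.one]⟩
  | append_singleton L a ih =>
    intro hL
    have haU : a ∈ U := hL a (by simp)
    obtain ⟨k, u, hu, v, hv, hprod, hk⟩ := ih fun x hx => hL x (by simp [hx])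
    have huv : u * v ∈ (insert 1 U) ^ (k + 1) := by
      rw [pow_succ]
      exact mul_mem_mul hu (mem_insert_of_mem _ (hsub hv))
    simp only [List.prod_append, List.prod_singleton, List.map_append, List.map_singleton,
      List.sum_append, List.sum_singleton, hprod]
    have hv0 := hN.nonneg v
    by_cases ha : N a < ε
    · have hc : stepCost N ε a = N a := by simp [stepCost, ha]
      rw [hc]
      by_cases hva : N v + N a < ε
      · refine ⟨k, u, hu, v * a, (hN.mul_le v a).trans_lt hva, by group, ?_⟩
        have h1 := hN.mul_le v a
        have h2 := hN.nonneg a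
        linarith
      -- Overflow: `v` becomes a letter and `a` the new remainder. The extra `ε` is at most `N v + N
      -- a`, covered by the old `N v` and half of the new `2 * N a`.
      · refine ⟨k + 1, u * v, huv, a, ha, rfl, ?_⟩
        push_cast
        linarith
    · have hc : stepCost N ε a = 1 := by simp [stepCost, ha]
      -- A large step closes `v` and contributes itself: two letters of weight `ε ≤ 1` against twice
      -- the cost 1.
      refine ⟨k + 2, u * v * a, ?_, 1, by rw [hN.one]; exact hε, by simp, ?_⟩
      · rw [pow_succ _ (k + 1)]
        exact mul_mem_mul huv (mem_insert_of_mem _ haU)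
      · rw [hc, hN.one]
        push_cast
        linarith

end ChainNorm

/-- A coarsely bounded set is contained in a power of any symmetric generating
neighbourhood of the identity. -/
theorem IsCoarselyBounded.subset_pow_of_mem_nhds [TopologicalSpace G] [IsTopologicalGroup G]
    [T1Space G] {N : G → ℝ} (hN : IsCompatibleNorm N) {T U : Set G} (hT : IsCoarselyBounded T)
    (hgen : ∀ g, ∃ n : ℕ, g ∈ U ^ n) (hinv : ∀ g ∈ U, g⁻¹ ∈ U) (hU : U ∈ 𝓝 (1 : G)) :
    ∃ k : ℕ, T ⊆ (insert 1 U) ^ k := by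
  obtain ⟨δ, hδ, hs⟩ := hN.basis.mem_iff.1 hU
  have hε : 0 < min δ 1 := lt_min hδ one_pos
  have hsub : {g | N g < min δ 1} ⊆ U := fun g (hg : N g < min δ 1) =>
    hs (show N g < δ from hg.trans_le (min_le_left _ _))
  set ε := min δ 1
  have hε1 : ε ≤ 1 := min_le_right _ _
  obtain ⟨C, hC⟩ := hT.exists_norm_le (isCompatibleNorm_chainNorm hN hε hε1 hgen hinv hsub)
  -- A chain of cost below `C + 1` yields at most `2 * (C + 1) / ε` letters, and the remainder `v`
  -- is one more.
  obtain ⟨K, hK⟩ := exists_nat_gt (2 * (C + 1) / ε)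
  refine ⟨K + 1, fun g hg => ?_⟩
  obtain ⟨L, h1, rfl, h3⟩ := exists_list_chainNorm_lt hgen g
    (show chainNorm N ε U g < C + 1 by linarith [hC g hg])
  obtain ⟨k, u, hu, v, hv, hprod, hk⟩ := exists_pow_mul_of_sum_stepCost hN hε hε1 hsub L h1
  have h4 : (k : ℝ) ≤ 2 * (C + 1) / ε := by
    rw [le_div_iff₀ hε]
    linarith [hN.nonneg v]
  have h5 : k ≤ K := by exact_mod_cast h4.trans hK.le
  rw [hprod]
  have h6 : u * v ∈ (insert 1 U) ^ (k + 1) := by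
    rw [pow_succ]
    exact mul_mem_mul hu (mem_insert_of_mem _ (hsub hv))
  exact pow_subset_pow_right (mem_insert _ _) (by omega) h6

end CompatibleNorm

/-! ### Word metrics -/

section WordMetric

variable {G : Type*} [Group G]

theorem exists_mem_pow_of_closure_eq_top {S : Set G} (hS : Subgroup.closure S = ⊤) (g : G) :
    ∃ n : ℕ, g ∈ (S ∪ S⁻¹) ^ n := by
  have hg : g ∈ Subgroup.closure S := hS ▸ Subgroup.mem_top g
  have hsym : (S ∪ S⁻¹)⁻¹ = S ∪ S⁻¹ := by rw [union_inv, inv_inv, union_comm]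
  induction hg using Subgroup.closure_induction with
  | mem x hx => exact ⟨1, by simpa using Or.inl hx⟩
  | one => exact ⟨0, by simp⟩
  | mul x y _ _ hx hy =>
    obtain ⟨m, hm⟩ := hx
    obtain ⟨n, hn⟩ := hy
    exact ⟨m + n, pow_add (S ∪ S⁻¹) m n ▸ mul_mem_mul hm hn⟩
  | inv x _ hx =>
    obtain ⟨m, hm⟩ := hx
    refine ⟨m, ?_⟩
    rw [← hsym, inv_pow]
    exact inv_mem_inv.2 hm

/-- Powers of a set need not increase with the exponent unless the set contains 1. Adjoining 1 makes
them nested, and deleting the trivial letters only shortens a word. -/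
theorem exists_mem_pow_of_mem_insert_one_pow {U : Set G} {k : ℕ} {g : G}
    (hg : g ∈ (insert 1 U) ^ k) : ∃ j ≤ k, g ∈ U ^ j := by
  induction k generalizing g with
  | zero => exact ⟨0, le_rfl, by simpa using hg⟩
  | succ k ih =>
    rw [pow_succ] at hg
    obtain ⟨a, ha, b, hb, rfl⟩ := mem_mul.1 hg
    obtain ⟨j, hj, haj⟩ := ih ha
    rcases hb with rfl | hb
    · exact ⟨j, by omega, by simpa using haj⟩
    · exact ⟨j + 1, by omega, pow_succ U j ▸ mul_mem_mul haj hb⟩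

theorem wordMetric_le {S : Set G} {x y : G} {k : ℕ} (h : x⁻¹ * y ∈ (insert 1 (S ∪ S⁻¹)) ^ k) :
    wordMetric S x y ≤ k := by
  obtain ⟨j, hj, hm⟩ := exists_mem_pow_of_mem_insert_one_pow h
  unfold wordMetric
  exact_mod_cast (Nat.sInf_le (show j ∈ {k : ℕ | x⁻¹ * y ∈ (S ∪ S⁻¹) ^ k} from hm)).trans hj

theorem wordMetric_nonneg (S : Set G) (x y : G) : 0 ≤ wordMetric S x y :=
  Nat.cast_nonneg _

theorem wordMetric_self (S : Set G) (x : G) : wordMetric S x x = 0 := by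
  refine le_antisymm ?_ (wordMetric_nonneg S x x)
  have := wordMetric_le (S := S) (x := x) (y := x) (k := 0) (by simp)
  simpa using this

theorem exists_wordMetric_eq {S : Set G} (hS : Subgroup.closure S = ⊤) (x y : G) :
    ∃ k : ℕ, wordMetric S x y = k ∧ x⁻¹ * y ∈ (S ∪ S⁻¹) ^ k :=
  ⟨_, rfl, Nat.sInf_mem (exists_mem_pow_of_closure_eq_top hS (x⁻¹ * y))⟩

theorem wordMetric_triangle {S : Set G} (hS : Subgroup.closure S = ⊤) (x y z : G) :
    wordMetric S x z ≤ wordMetric S x y + wordMetric S y z := by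
  obtain ⟨k, hk, hk'⟩ := exists_wordMetric_eq hS x y
  obtain ⟨l, hl, hl'⟩ := exists_wordMetric_eq hS y z
  rw [hk, hl]
  refine (wordMetric_le (k := k + l) ?_).trans_eq (by push_cast; rfl)
  have : x⁻¹ * z = (x⁻¹ * y) * (y⁻¹ * z) := by group
  rw [this, pow_add]
  exact mul_mem_mul (pow_subset_pow_left (subset_insert _ _) hk')
    (pow_subset_pow_left (subset_insert _ _) hl')

end WordMetric

/-! ### Composition and inversion of quasi-isometries -/

section QuasiIsometry

variable {X Y Z : Type*}

theorem IsQuasiIsometry.comp {d : X → X → ℝ} {d' : Y → Y → ℝ} {d'' : Z → Z → ℝ} {φ : X → Y}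
    {ψ : Y → Z} (hψ : IsQuasiIsometry d' d'' ψ) (hφ : IsQuasiIsometry d d' φ)
    (htri : ∀ x y z, d'' x z ≤ d'' x y + d'' y z) : IsQuasiIsometry d d'' (ψ ∘ φ) := by
  obtain ⟨K, hK, C, hC, h1, h2⟩ := hφ
  obtain ⟨L, hL, D, hD, h3, h4⟩ := hψ
  have hL0 : 0 < L := by linarith
  have hLinv : 0 ≤ L⁻¹ := by positivity
  have hLinv1 : L⁻¹ ≤ 1 := inv_le_one_of_one_le₀ hL
  -- The second `D` is needed for coarse surjectivity only: one `D` is lost in comparing images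
  -- under `ψ`, the other in reaching `z`.
  refine ⟨L * K, by nlinarith, L * C + D + D, by positivity, fun x x' => ⟨?_, ?_⟩, fun z => ?_⟩
  · have h5 := (h3 (φ x) (φ x')).1
    have h6 := mul_le_mul_of_nonneg_left (h1 x x').1 hLinv
    have h7 : L⁻¹ * C ≤ L * C := mul_le_mul_of_nonneg_right (hLinv1.trans hL) hC
    rw [mul_inv]
    simp only [Function.comp]
    nlinarith
  · have h5 := (h3 (φ x) (φ x')).2
    have h6 := mul_le_mul_of_nonneg_left (h1 x x').2 hL0.le
    simp only [Function.comp]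
    nlinarith
  · obtain ⟨y, hy⟩ := h4 z
    obtain ⟨x, hx⟩ := h2 y
    refine ⟨x, ?_⟩
    have h5 := (h3 (φ x) y).2
    have h6 := mul_le_mul_of_nonneg_left hx hL0.le
    have h7 := htri (ψ (φ x)) (ψ y) z
    simp only [Function.comp]
    linarith

theorem IsQuasiIsometry.symm_id {d d' : X → X → ℝ} (h : IsQuasiIsometry d d' (id : X → X))
    (hself : ∀ x, d x x = 0) : IsQuasiIsometry d' d (id : X → X) := by
  obtain ⟨K, hK, C, hC, h1, h2⟩ := h
  have hK0 : 0 < K := by linarith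
  have hKinv : K⁻¹ ≤ 1 := inv_le_one_of_one_le₀ hK
  refine ⟨K, hK, K * C, by positivity, fun x x' => ⟨?_, ?_⟩, fun y => ⟨y, ?_⟩⟩
  · have h3 := (h1 x x').2
    have h4 := mul_le_mul_of_nonneg_left h3 (inv_nonneg.2 hK0.le)
    rw [mul_add, inv_mul_cancel_left₀ hK0.ne'] at h4
    have h5 : K⁻¹ * C ≤ K * C := mul_le_mul_of_nonneg_right (hKinv.trans hK) hC
    simp only [id] at h4 ⊢
    linarith
  · have h3 := (h1 x x').1
    have h4 := mul_le_mul_of_nonneg_left h3 hK0.le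
    rw [mul_sub, mul_inv_cancel_left₀ hK0.ne'] at h4
    simp only [id] at h4 ⊢
    linarith
  · simp only [id, hself]
    positivity

end QuasiIsometry

/-! ### Independence of the quasi-isometry type from the generating set -/

section CoarseType

variable {G : Type*} [Group G] [TopologicalSpace G]

/-- The set `S ∪ S⁻¹` need not be an identity neighbourhood, but one of its powers is, and the chain
norm is applied to that power. This is the single fact behind all comparisons of word metrics below.
-/
theorem IsPolishGroup.exists_subset_pow (hG : IsPolishGroup G) {N : G → ℝ}
    (hN : IsCompatibleNorm N) {S T : Set G} (hS : IsCoarseGeneratingSet S)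
    (hT : IsCoarselyBounded T) : ∃ k : ℕ, T ⊆ (insert 1 (S ∪ S⁻¹)) ^ k := by
  obtain ⟨_, _⟩ := hG
  set U := S ∪ S⁻¹ with hU
  have hinv : U⁻¹ = U := by rw [hU, union_inv, inv_inv, union_comm]
  have hgen := exists_mem_pow_of_closure_eq_top hS.2.2
  obtain ⟨n, hn⟩ := exists_pow_mem_nhds_one (hS.1.union hS.1.inv) hinv hgen
  -- The exponent `n + 1` keeps `U` inside the power even if `n = 0`.
  have hsub : U ⊆ (insert 1 U) ^ (n + 1) :=
    (subset_insert 1 U).trans (Set.subset_pow (mem_insert _ _) (Nat.succ_ne_zero n))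
  have hn' : U ^ n ⊆ (insert 1 U) ^ (n + 1) :=
    (pow_subset_pow_left (subset_insert 1 U)).trans
      (pow_subset_pow_right (mem_insert _ _) (Nat.le_succ n))
  have hinv' : (insert 1 U)⁻¹ = insert 1 U := by rw [inv_insert, inv_one, hinv]
  obtain ⟨k, hk⟩ := hT.subset_pow_of_mem_nhds hN (U := (insert 1 U) ^ (n + 1))
    (fun g => (hgen g).imp fun j hj => pow_subset_pow_left hsub hj)
    (fun g hg => by
      rw [← hinv', inv_pow]
      exact inv_mem_inv.2 hg)
    (mem_of_superset hn hn')
  have h1 : (1 : G) ∈ (insert 1 U) ^ (n + 1) := one_mem_pow (mem_insert _ _)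
  rw [insert_eq_of_mem h1, ← pow_mul] at hk
  exact ⟨_, hk⟩

theorem IsPolishGroup.exists_wordMetric_le (hG : IsPolishGroup G) {N : G → ℝ}
    (hN : IsCompatibleNorm N) {S T : Set G} (hS : IsCoarseGeneratingSet S)
    (hT : IsCoarseGeneratingSet T) :
    ∃ k : ℕ, ∀ x y, wordMetric S x y ≤ k * wordMetric T x y := by
  obtain ⟨k, hk⟩ := hG.exists_subset_pow hN hS hT.2.1
  have hsym : ((insert 1 (S ∪ S⁻¹)) ^ k)⁻¹ = (insert 1 (S ∪ S⁻¹)) ^ k := by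
    rw [← inv_pow, inv_insert, inv_one, union_inv, inv_inv, union_comm]
  have hk' : T ∪ T⁻¹ ⊆ (insert 1 (S ∪ S⁻¹)) ^ k := by
    refine union_subset hk ?_
    rw [← hsym]
    exact inv_subset_inv.2 hk
  refine ⟨k, fun x y => ?_⟩
  obtain ⟨l, hl, hl'⟩ := exists_wordMetric_eq hT.2.2 x y
  rw [hl]
  refine (wordMetric_le (k := k * l) ?_).trans_eq (by push_cast; rfl)
  rw [pow_mul]
  exact pow_subset_pow_left hk' hl'

theorem IsPolishGroup.isQuasiIsometry_wordMetric (hG : IsPolishGroup G) {N : G → ℝ}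
    (hN : IsCompatibleNorm N) {S T : Set G} (hS : IsCoarseGeneratingSet S)
    (hT : IsCoarseGeneratingSet T) :
    IsQuasiIsometry (wordMetric S) (wordMetric T) (id : G → G) := by
  obtain ⟨k, hk⟩ := hG.exists_wordMetric_le hN hS hT
  obtain ⟨l, hl⟩ := hG.exists_wordMetric_le hN hT hS
  have hpos : (0 : ℝ) < k + l + 1 := by positivity
  have hk0 : (0 : ℝ) ≤ k := Nat.cast_nonneg _
  have hl0 : (0 : ℝ) ≤ l := Nat.cast_nonneg _
  refine ⟨k + l + 1, by linarith, 0, le_rfl, fun x x' => ⟨?_, ?_⟩, fun y => ⟨y, ?_⟩⟩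
  · rw [sub_zero, inv_mul_le_iff₀ hpos]
    have h1 := wordMetric_nonneg T x x'
    have h2 := hk x x'
    simp only [id]
    nlinarith
  · have h1 := wordMetric_nonneg S x x'
    have h2 := hl x x'
    simp only [id]
    nlinarith
  · exact (wordMetric_self T y).le

theorem IsPolishGroup.hasWellDefinedQIType (hG : IsPolishGroup G) {N : G → ℝ}
    (hN : IsCompatibleNorm N) {S : Set G} (hS : IsCoarseGeneratingSet S) :
    HasWellDefinedQIType G :=
  ⟨⟨S, hS⟩, fun _ _ => hG.isQuasiIsometry_wordMetric hN⟩

theorem IsCoarseGeneratingSet.isGeneratedByCoarselyBounded {S : Set G}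
    (hS : IsCoarseGeneratingSet S) : IsGeneratedByCoarselyBounded G :=
  ⟨S, hS.2.1, hS.2.2⟩

theorem IsCoarselyBoundedGroup.isCoarseGeneratingSet_univ (hG : IsCoarselyBoundedGroup G) :
    IsCoarseGeneratingSet (univ : Set G) :=
  ⟨isClosed_univ, hG, Subgroup.closure_univ⟩

theorem isCoarselyBoundedGroup_unit : IsCoarselyBoundedGroup Unit := by
  intro m _ _
  refine ⟨0, fun x _ y _ => ?_⟩
  rw [Subsingleton.elim x y]
  exact (m.dist_self y).le

theorem isPolishGroup_unit : IsPolishGroup Unit :=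
  ⟨inferInstance, inferInstance⟩

/-- The whole group lies in one power of any admissible generating set, so its word metrics, and
with them all representing metrics, are bounded. -/
theorem IsPolishGroup.hasTrivialQIType (hG : IsPolishGroup G) {N : G → ℝ}
    (hN : IsCompatibleNorm N) (hb : IsCoarselyBoundedGroup G) : HasTrivialQIType G := by
  refine ⟨fun _ => (), hG, isPolishGroup_unit,
    hb.isCoarseGeneratingSet_univ.isGeneratedByCoarselyBounded,
    isCoarselyBoundedGroup_unit.isCoarseGeneratingSet_univ.isGeneratedByCoarselyBounded, ?_⟩
  rintro mG mH ⟨S, hS, hSG⟩ -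
  obtain ⟨k, hk⟩ := hG.exists_subset_pow hN hS hb
  obtain ⟨K, hK, C, hC, h1, -⟩ := hSG
  have hK0 : 0 < K := by linarith
  have hmH : ∀ x y : Unit, mH.dist x y = 0 := fun x y => by
    rw [Subsingleton.elim x y]
    exact mH.dist_self y
  have hbound : ∀ x y, mG.dist x y ≤ K * (k + C) := by
    intro x y
    have h2 := (h1 x y).1
    have h3 : wordMetric S (id x) (id y) ≤ k := wordMetric_le (hk (mem_univ _))
    have h4 := mul_le_mul_of_nonneg_left (h2.trans h3) hK0.le
    rw [mul_sub, mul_inv_cancel_left₀ hK0.ne'] at h4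
    linarith
  have hD : 0 ≤ K * (k + C) := by positivity
  refine ⟨1, le_rfl, K * (k + C), hD, fun x x' => ?_, fun y => ⟨1, ?_⟩⟩
  · rw [hmH]
    have h2 := hbound x x'
    have h3 : 0 ≤ mG.dist x x' := dist_nonneg
    constructor
    · linarith
    · linarith
  · rw [hmH]
    exact hD

/-- A map that is a quasi-isometry for one pair of word metrics is a quasi-isometry of Polish
groups. -/
theorem isPolishQuasiIsometry_of_wordMetric {H : Type*} [Group H] [TopologicalSpace H]
    (hG : IsPolishGroup G) (hH : IsPolishGroup H) {N : G → ℝ} (hN : IsCompatibleNorm N)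
    {N' : H → ℝ} (hN' : IsCompatibleNorm N') {S : Set G} {T : Set H}
    (hS : IsCoarseGeneratingSet S) (hT : IsCoarseGeneratingSet T) {φ : G → H}
    (hφ : IsQuasiIsometry (wordMetric S) (wordMetric T) φ) : IsPolishQuasiIsometry φ := by
  refine ⟨hG, hH, hS.isGeneratedByCoarselyBounded, hT.isGeneratedByCoarselyBounded, ?_⟩
  rintro mG mH ⟨S', hS', hSG⟩ ⟨T', hT', hTH⟩
  have h1 := (hG.isQuasiIsometry_wordMetric hN hS' hS).comp hSG (wordMetric_triangle hS.2.2)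
  have h2 := hφ.comp h1 (wordMetric_triangle hT.2.2)
  have h3 := (hH.isQuasiIsometry_wordMetric hN' hT hT').comp h2 (wordMetric_triangle hT'.2.2)
  exact (hTH.symm_id mH.dist_self).comp h3 mH.dist_triangle

end CoarseType

/-! ### Locally absolutely continuous functions commuting with the unit translation -/

theorem LocallyAbsolutelyContinuous.continuous {f : ℝ → ℝ} (hf : LocallyAbsolutelyContinuous f) :
    Continuous f := by
  rw [continuous_iff_continuousAt]
  intro x
  refine (hf (x - 1) (x + 1)).continuousOn.continuousAt ?_
  rw [uIcc_of_le (by linarith)]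
  exact Icc_mem_nhds (by linarith) (by linarith)

theorem LocallyAbsolutelyContinuous.ae_differentiableAt {f : ℝ → ℝ}
    (hf : LocallyAbsolutelyContinuous f) : ∀ᵐ x, DifferentiableAt ℝ f x := by
  have h : ∀ n : ℕ, ∀ᵐ x : ℝ, x ∈ uIcc (-(n : ℝ)) n → DifferentiableAt ℝ f x :=
    fun n => (hf _ _).ae_differentiableAt
  filter_upwards [ae_all_iff.2 h] with x hx
  obtain ⟨n, hn⟩ := exists_nat_ge |x|
  refine hx n ?_
  rw [uIcc_of_le (by linarith [abs_nonneg x])]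
  exact abs_le.1 hn

theorem map_add_intCast_of_map_add_one {f : ℝ → ℝ} (hf : ∀ x, f (x + 1) = f x + 1) (x : ℝ)
    (n : ℤ) : f (x + n) = f x + n := by
  induction n with
  | zero => simp
  | succ n ih =>
    have h := hf (x + n)
    push_cast at ih ⊢
    rw [← add_assoc, h, ih, add_assoc]
  | pred n ih =>
    have h := hf (x + -n - 1)
    rw [sub_add_cancel] at h
    push_cast at ih ⊢
    rw [← add_sub_assoc]
    linarith

theorem periodic_deriv_of_map_add_one {f : ℝ → ℝ} (hf : ∀ x, f (x + 1) = f x + 1) :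
    Function.Periodic (deriv f) 1 := by
  intro x
  rw [← deriv_comp_add_const, funext hf, deriv_add_const]

theorem derivDist_nonneg (f g : ℝ → ℝ) : 0 ≤ derivDist f g :=
  intervalIntegral.integral_nonneg zero_le_one fun _ _ => abs_nonneg _

/-- By the fundamental theorem of calculus. As a consequence the value at 0 and the derivative in
`L¹` control the uniform distance, and with it the whole topology. -/
theorem abs_sub_le_of_mem_Icc {f g : ℝ → ℝ} (hf : LocallyAbsolutelyContinuous f)
    (hg : LocallyAbsolutelyContinuous g) {x : ℝ} (hx : x ∈ Icc (0 : ℝ) 1) :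
    |f x - g x| ≤ |f 0 - g 0| + derivDist f g := by
  have h1 := (hf 0 x).integral_deriv_eq_sub
  have h2 := (hg 0 x).integral_deriv_eq_sub
  have i1 := (hf 0 x).intervalIntegrable_deriv
  have i2 := (hg 0 x).intervalIntegrable_deriv
  have h3 : f x - g x = (f 0 - g 0) + ∫ t in (0 : ℝ)..x, (deriv f t - deriv g t) := by
    rw [intervalIntegral.integral_sub i1 i2, h1, h2]
    ring
  rw [h3]
  refine (abs_add_le _ _).trans (add_le_add le_rfl ?_)
  refine (intervalIntegral.abs_integral_le_integral_abs hx.1).trans ?_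
  refine intervalIntegral.integral_mono_interval le_rfl hx.1 hx.2 ?_
    (((hf 0 1).intervalIntegrable_deriv.sub (hg 0 1).intervalIntegrable_deriv).abs)
  exact Eventually.of_forall fun _ => abs_nonneg _

theorem abs_sub_le_of_map_add_one {f g : ℝ → ℝ} (hf : LocallyAbsolutelyContinuous f)
    (hg : LocallyAbsolutelyContinuous g) (hf1 : ∀ x, f (x + 1) = f x + 1)
    (hg1 : ∀ x, g (x + 1) = g x + 1) (x : ℝ) :
    |f x - g x| ≤ |f 0 - g 0| + derivDist f g := by
  have h1 := map_add_intCast_of_map_add_one hf1 (Int.fract x) ⌊x⌋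
  have h2 := map_add_intCast_of_map_add_one hg1 (Int.fract x) ⌊x⌋
  rw [Int.fract_add_floor] at h1 h2
  rw [h1, h2, add_sub_add_right_eq_sub]
  exact abs_sub_le_of_mem_Icc hf hg ⟨Int.fract_nonneg x, (Int.fract_lt_one x).le⟩

/-- A density of mass one is the derivative of a function commuting with the unit translation. -/
theorem exists_locallyAbsolutelyContinuous_deriv_ae_eq {φ : ℝ → ℝ}
    (hφ : Integrable φ (volume.restrict (Ioc 0 1))) (h1 : ∫ t in (0 : ℝ)..1, φ t = 1) (c : ℝ) :
    ∃ f : ℝ → ℝ, LocallyAbsolutelyContinuous f ∧ (∀ x, f (x + 1) = f x + 1) ∧ f 0 = c ∧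
      deriv f =ᵐ[volume.restrict (Ioc 0 1)] φ := by
  -- The 1-periodic extension of `φ`, with representatives in `(0, 1]`; its primitive gains exactly
  -- the mass 1 over each period.
  let ψ : ℝ → ℝ := fun x => φ (toIocMod one_pos (0 : ℝ) x)
  have hψφ : ∀ x ∈ Ioc (0 : ℝ) 1, ψ x = φ x := fun x hx => by
    change φ _ = φ _
    rw [(toIocMod_eq_self one_pos).2 (by simpa using hx)]
  have hper : Function.Periodic ψ 1 := fun x => by
    change φ _ = φ _
    rw [toIocMod_periodic one_pos (0 : ℝ) x]
  have hint01 : IntervalIntegrable ψ volume 0 (0 + 1) := by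
    rw [zero_add, intervalIntegrable_iff_integrableOn_Ioc_of_le zero_le_one]
    exact (integrableOn_congr_fun hψφ measurableSet_Ioc).2 hφ
  have hint : ∀ a b, IntervalIntegrable ψ volume a b := hper.intervalIntegrable one_ne_zero hint01
  refine ⟨fun x => c + ∫ t in (0 : ℝ)..x, ψ t, fun a b => ?_, fun x => ?_, by simp, ?_⟩
  · have hsub : uIcc a b ⊆ uIcc (min (min a b) 0) (max (max a b) 0) := by
      have hle : min (min a b) 0 ≤ max (max a b) 0 := (min_le_right _ _).trans (le_max_right _ _)
      rw [uIcc_of_le hle]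
      exact Icc_subset_Icc (min_le_left _ _) (le_max_left _ _)
    have := (hint (min (min a b) 0) (max (max a b) 0)
      ).absolutelyContinuousOnInterval_intervalIntegral (c := 0) (by simp)
    exact ((LipschitzWith.const c).lipschitzOnWith.absolutelyContinuousOnInterval).add
      (this.mono hsub)
  · have h2 := intervalIntegral.integral_add_adjacent_intervals (hint 0 x) (hint x (x + 1))
    have h3 := hper.intervalIntegral_add_eq x 0
    have h4 : ∫ t in (0 : ℝ)..1, ψ t = 1 := by
      refine Eq.trans ?_ h1
      refine intervalIntegral.integral_congr_ae (Eventually.of_forall fun t ht => hψφ t ?_)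
      rwa [uIoc_of_le zero_le_one] at ht
    rw [zero_add, h4] at h3
    simp only
    rw [← h2, h3, add_assoc]
  · have h2 := (hint 0 1).ae_hasDerivAt_integral
    rw [EventuallyEq, ae_restrict_iff' measurableSet_Ioc]
    filter_upwards [h2] with x hx hx01
    have h3 := (hx (by rw [uIcc_of_le zero_le_one]; exact Ioc_subset_Icc_self hx01) 0 (by simp))
    rw [(h3.const_add c).deriv, hψφ x hx01]

/-- A function commuting with the unit translation is locally absolutely continuous if it is
absolutely continuous on the unit interval. -/
theorem locallyAbsolutelyContinuous_of_map_add_one {f : ℝ → ℝ}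
    (hf : AbsolutelyContinuousOnInterval f 0 1) (hf1 : ∀ x, f (x + 1) = f x + 1) :
    LocallyAbsolutelyContinuous f := by
  have hi := hf.intervalIntegrable_deriv
  rw [intervalIntegrable_iff_integrableOn_Ioc_of_le zero_le_one] at hi
  have h1 : ∫ t in (0 : ℝ)..1, deriv f t = 1 := by
    rw [hf.integral_deriv_eq_sub]
    have := hf1 0
    rw [zero_add] at this
    linarith
  -- The primitive `g` of the periodised derivative agrees with `f` on the unit interval, hence
  -- everywhere by equivariance.
  obtain ⟨g, hg, hg1, hg0, hgf⟩ := exists_locallyAbsolutelyContinuous_deriv_ae_eq hi h1 (f 0)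
  suffices f = g by rwa [this]
  have key : ∀ x ∈ Icc (0 : ℝ) 1, f x = g x := by
    intro x hx
    have h2 := (hf.mono (c := 0) (d := x) (by
      rw [uIcc_of_le hx.1, uIcc_of_le zero_le_one]
      exact Icc_subset_Icc_right hx.2)).integral_deriv_eq_sub
    have h3 := (hg 0 x).integral_deriv_eq_sub
    have h4 : ∫ t in (0 : ℝ)..x, deriv g t = ∫ t in (0 : ℝ)..x, deriv f t := by
      refine intervalIntegral.integral_congr_ae ?_
      rw [EventuallyEq, ae_restrict_iff' measurableSet_Ioc] at hgf
      filter_upwards [hgf] with t ht ht'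
      rw [uIoc_of_le hx.1] at ht'
      exact ht ⟨ht'.1, ht'.2.trans hx.2⟩
    linarith
  funext x
  have h1 := map_add_intCast_of_map_add_one hf1 (Int.fract x) ⌊x⌋
  have h2 := map_add_intCast_of_map_add_one hg1 (Int.fract x) ⌊x⌋
  rw [Int.fract_add_floor] at h1 h2
  rw [h1, h2, key _ ⟨Int.fract_nonneg x, (Int.fract_lt_one x).le⟩]

/-! ### Absolutely continuous homeomorphisms of the line -/

namespace ACZLoc

theorem map_add_one (f : ACZLoc) (x : ℝ) : f.1 (x + 1) = f.1 x + 1 := by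
  simpa using f.2.1 x 1

theorem map_add_intCast (f : ACZLoc) (x : ℝ) (n : ℤ) : f.1 (x + n) = f.1 x + n :=
  f.2.1 x n

theorem strictMono (f : ACZLoc) : StrictMono f.1 :=
  strictMono_of_add_intCast f.2.1

theorem locallyAC (f : ACZLoc) : LocallyAbsolutelyContinuous f.1 :=
  f.2.2.1

theorem intervalIntegrable_deriv (f : ACZLoc) (a b : ℝ) :
    IntervalIntegrable (deriv f.1) volume a b :=
  (f.locallyAC a b).intervalIntegrable_deriv

theorem integral_deriv (f : ACZLoc) (a b : ℝ) : ∫ t in a..b, deriv f.1 t = f.1 b - f.1 a :=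
  (f.locallyAC a b).integral_deriv_eq_sub

theorem deriv_nonneg (f : ACZLoc) (x : ℝ) : 0 ≤ deriv f.1 x :=
  f.strictMono.monotone.deriv_nonneg

@[simp] theorem mul_apply (f g : ACZLoc) (x : ℝ) : (f * g).1 x = f.1 (g.1 x) := rfl

@[simp] theorem inv_apply_self (f : ACZLoc) (x : ℝ) : (f⁻¹).1 (f.1 x) = x :=
  f.1.symm_apply_apply x

@[simp] theorem apply_inv_self (f : ACZLoc) (x : ℝ) : f.1 ((f⁻¹).1 x) = x :=
  f.1.apply_symm_apply x

@[simp] theorem one_apply (x : ℝ) : (1 : ACZLoc).1 x = x := rfl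

theorem dist_def (f g : ACZLoc) : dist f g = supDistI f.1 g.1 + derivDist f.1 g.1 := rfl

theorem supDistI_le (f g : ACZLoc) : supDistI f.1 g.1 ≤ |f.1 0 - g.1 0| + derivDist f.1 g.1 :=
  ciSup_le fun x => abs_sub_le_of_mem_Icc f.locallyAC g.locallyAC x.2

theorem abs_sub_le_supDistI (f g : ACZLoc) (x : ℝ) : |f.1 x - g.1 x| ≤ supDistI f.1 g.1 := by
  have h1 := f.map_add_intCast (Int.fract x) ⌊x⌋
  have h2 := g.map_add_intCast (Int.fract x) ⌊x⌋
  rw [Int.fract_add_floor] at h1 h2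
  rw [h1, h2, add_sub_add_right_eq_sub]
  exact le_ciSup (supDistI_bddAbove f.1 g.1)
    ⟨Int.fract x, Int.fract_nonneg x, (Int.fract_lt_one x).le⟩

theorem supDistI_nonneg (f g : ACZLoc) : 0 ≤ supDistI f.1 g.1 :=
  (abs_nonneg _).trans (abs_sub_le_supDistI f g 0)

theorem abs_sub_le_dist (f g : ACZLoc) (x : ℝ) : |f.1 x - g.1 x| ≤ dist f g := by
  have := abs_sub_le_supDistI f g x
  have := derivDist_nonneg f.1 g.1
  rw [dist_def]
  linarith

theorem derivDist_le_dist (f g : ACZLoc) : derivDist f.1 g.1 ≤ dist f g := by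
  have := supDistI_nonneg f g
  rw [dist_def]
  linarith

theorem dist_le (f g : ACZLoc) : dist f g ≤ |f.1 0 - g.1 0| + 2 * derivDist f.1 g.1 := by
  have := supDistI_le f g
  rw [dist_def]
  linarith

/-- The image measure of Lebesgue measure under `f⁻¹` has density `f'`. -/
theorem map_inv_volume (f : ACZLoc) :
    Measure.map (f⁻¹).1 volume = volume.withDensity fun x => ENNReal.ofReal (deriv f.1 x) := by
  symm
  have hIoc : ∀ a b : ℝ, a ≤ b →
      (volume.withDensity fun x => ENNReal.ofReal (deriv f.1 x)) (Ioc a b) =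
        ENNReal.ofReal (f.1 b - f.1 a) := by
    intro a b hab
    rw [withDensity_apply _ measurableSet_Ioc, ← ofReal_integral_eq_lintegral_ofReal,
      ← intervalIntegral.integral_of_le hab, f.integral_deriv]
    · exact (intervalIntegrable_iff_integrableOn_Ioc_of_le hab).1 (f.intervalIntegrable_deriv a b)
    · exact Eventually.of_forall fun x => f.deriv_nonneg x
  have : IsLocallyFiniteMeasure
      (volume.withDensity fun x => ENNReal.ofReal (deriv f.1 x)) := by
    refine ⟨fun x => ⟨Ioc (x - 1) (x + 1), Ioc_mem_nhds (by linarith) (by linarith), ?_⟩⟩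
    rw [hIoc _ _ (by linarith)]
    exact ENNReal.ofReal_lt_top
  refine Measure.ext_of_Ioc _ _ fun a b hab => ?_
  rw [hIoc a b hab.le, Measure.map_apply (f⁻¹).1.continuous.measurable measurableSet_Ioc]
  have : (f⁻¹).1 ⁻¹' Ioc a b = Ioc (f.1 a) (f.1 b) := by
    ext y
    have h1 : a < (f⁻¹).1 y ↔ f.1 a < y := by
      rw [← f.strictMono.lt_iff_lt, apply_inv_self]
    have h2 : (f⁻¹).1 y ≤ b ↔ y ≤ f.1 b := by
      rw [← f.strictMono.le_iff_le, apply_inv_self]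
    simp only [mem_preimage, mem_Ioc, h1, h2]
  rw [this, Real.volume_Ioc]

/-- Absolute continuity of `f⁻¹` makes preimages of null sets under `f` null. This is what allows an
almost everywhere statement to be composed with `f`, as in the chain rule. -/
theorem quasiMeasurePreserving (f : ACZLoc) :
    Measure.QuasiMeasurePreserving f.1 volume volume := by
  refine ⟨f.1.continuous.measurable, ?_⟩
  have := f⁻¹.map_inv_volume
  rw [inv_inv] at this
  rw [this]
  exact withDensity_absolutelyContinuous _ _

theorem ae_hasDerivAt (f : ACZLoc) : ∀ᵐ x, HasDerivAt f.1 (deriv f.1 x) x := by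
  filter_upwards [f.locallyAC.ae_differentiableAt] with x hx using hx.hasDerivAt

theorem ae_deriv_mul (f g : ACZLoc) :
    ∀ᵐ x, deriv (f * g).1 x = deriv f.1 (g.1 x) * deriv g.1 x := by
  filter_upwards [g.quasiMeasurePreserving.ae f.ae_hasDerivAt, g.ae_hasDerivAt] with x h1 h2
  exact (h1.comp x h2).deriv

section ChangeOfVariables

variable (h : ACZLoc) {a b : ℝ} (φ : ℝ → ℝ)

theorem inv_preimage_Ioc (a b : ℝ) : h.1 ⁻¹' Ioc (h.1 a) (h.1 b) = Ioc a b := by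
  ext x
  simp [h.strictMono.lt_iff_lt, h.strictMono.le_iff_le]

/-- Substitution read off from the image measure formula, so no regularity of `φ` is required. -/
theorem integral_comp_mul_deriv (hab : a ≤ b) :
    ∫ x in a..b, φ (h.1 x) * deriv h.1 x = ∫ y in h.1 a..h.1 b, φ y := by
  rw [intervalIntegral.integral_of_le hab,
    intervalIntegral.integral_of_le (h.strictMono.monotone hab)]
  have h1 := setIntegral_withDensity_eq_setIntegral_toReal_smul (μ := volume)
    (f := fun x => ENNReal.ofReal (deriv h.1 x)) (s := Ioc a b)
    (measurable_deriv _).ennreal_ofReal (by simp) (fun x => φ (h.1 x)) measurableSet_Ioc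
  rw [← map_inv_volume, (h⁻¹).1.measurableEmbedding.setIntegral_map] at h1
  have h2 : (h⁻¹).1 ⁻¹' Ioc a b = Ioc (h.1 a) (h.1 b) := by
    have := inv_preimage_Ioc h⁻¹ (h.1 a) (h.1 b)
    simpa using this
  rw [h2] at h1
  simp only [apply_inv_self] at h1
  rw [h1]
  refine integral_congr_ae (Eventually.of_forall fun x => ?_)
  simp [ENNReal.toReal_ofReal (h.deriv_nonneg x), mul_comm]

theorem intervalIntegrable_comp_mul_deriv (hab : a ≤ b)
    (hφ : IntervalIntegrable φ volume (h.1 a) (h.1 b)) :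
    IntervalIntegrable (fun x => φ (h.1 x) * deriv h.1 x) volume a b := by
  rw [intervalIntegrable_iff_integrableOn_Ioc_of_le (h.strictMono.monotone hab)] at hφ
  rw [intervalIntegrable_iff_integrableOn_Ioc_of_le hab]
  have h2 : (h⁻¹).1 ⁻¹' Ioc a b = Ioc (h.1 a) (h.1 b) := by
    have := inv_preimage_Ioc h⁻¹ (h.1 a) (h.1 b)
    simpa using this
  have h3 : IntegrableOn (fun x => φ (h.1 x)) (Ioc a b) (Measure.map (h⁻¹).1 volume) := by
    rw [(h⁻¹).1.measurableEmbedding.integrableOn_map_iff, h2]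
    simpa [Function.comp_def] using hφ
  rw [map_inv_volume, IntegrableOn, restrict_withDensity measurableSet_Ioc,
    integrable_withDensity_iff_integrable_smul' (measurable_deriv _).ennreal_ofReal (by simp)] at h3
  refine h3.congr (Eventually.of_forall fun x => ?_)
  simp [ENNReal.toReal_ofReal (h.deriv_nonneg x), mul_comm]

end ChangeOfVariables

/-- The chain rule produces the factor `h'`, substitution moves the integral to the interval from
`h(0)` to `h(0) + 1`, and periodicity of the derivatives moves it back. -/
theorem derivDist_mul_right (f g h : ACZLoc) :
    derivDist (f * h).1 (g * h).1 = derivDist f.1 g.1 := by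
  unfold derivDist
  have h1 : ∫ t in (0 : ℝ)..1, |deriv (f * h).1 t - deriv (g * h).1 t| =
      ∫ t in (0 : ℝ)..1, |deriv f.1 (h.1 t) - deriv g.1 (h.1 t)| * deriv h.1 t := by
    refine intervalIntegral.integral_congr_ae ?_
    filter_upwards [ae_deriv_mul f h, ae_deriv_mul g h] with t h1 h2 _
    rw [h1, h2, ← sub_mul, abs_mul, abs_of_nonneg (h.deriv_nonneg t)]
  rw [h1, h.integral_comp_mul_deriv (fun y => |deriv f.1 y - deriv g.1 y|) zero_le_one]
  have hper : Function.Periodic (fun y => |deriv f.1 y - deriv g.1 y|) 1 := fun x => by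
    simp only [periodic_deriv_of_map_add_one f.map_add_one x,
      periodic_deriv_of_map_add_one g.map_add_one x]
  have h2 := hper.intervalIntegral_add_eq (h.1 0) 0
  have h3 := h.map_add_one 0
  rw [zero_add] at h2 h3
  rw [h3, h2]

theorem supDistI_mul_right_le (f g h : ACZLoc) :
    supDistI (f * h).1 (g * h).1 ≤ supDistI f.1 g.1 :=
  ciSup_le fun x => abs_sub_le_supDistI f g (h.1 x)

theorem dist_mul_right (f g h : ACZLoc) : dist (f * h) (g * h) = dist f g := by
  rw [dist_def, dist_def, derivDist_mul_right]
  congr 1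
  refine le_antisymm (supDistI_mul_right_le f g h) ?_
  have := supDistI_mul_right_le (f * h) (g * h) h⁻¹
  rwa [mul_inv_cancel_right, mul_inv_cancel_right] at this

end ACZLoc

/-! ### Continuity of left translations -/

namespace ACZLoc

/-- The derivative of `f` is only integrable, so it is replaced by a continuous `c`. The two
replacement errors become the outer integrals by substitution; the remaining terms use the closeness
of `c ∘ g` to `c ∘ h`, with `g'` of mass 1, and that of `g'` to `h'`. -/
theorem derivDist_mul_left_le (f g h : ACZLoc) {c : ℝ → ℝ} (hc : Continuous c) {η M : ℝ}
    (hM : ∀ x, |c x| ≤ M) (hη : ∀ x, |c (g.1 x) - c (h.1 x)| ≤ η) :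
    derivDist (f * g).1 (f * h).1 ≤ (∫ y in g.1 0..g.1 1, |deriv f.1 y - c y|) + η +
      M * derivDist g.1 h.1 + ∫ y in h.1 0..h.1 1, |deriv f.1 y - c y| := by
  have hφ : ∀ a b, IntervalIntegrable (fun y => |deriv f.1 y - c y|) volume a b := fun a b =>
    ((f.intervalIntegrable_deriv a b).sub (hc.intervalIntegrable a b)).abs
  have i1 := g.intervalIntegrable_comp_mul_deriv _ zero_le_one (hφ _ _)
  have i2 := h.intervalIntegrable_comp_mul_deriv _ zero_le_one (hφ _ _)
  have i3 := (g.intervalIntegrable_deriv 0 1).const_mul η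
  have i4 :=
    (((g.intervalIntegrable_deriv 0 1).sub (h.intervalIntegrable_deriv 0 1)).abs).const_mul M
  have i5 := (((f * g).intervalIntegrable_deriv 0 1).sub ((f * h).intervalIntegrable_deriv 0 1)).abs
  have hη1 : ∫ t in (0 : ℝ)..1, η * deriv g.1 t = η := by
    rw [intervalIntegral.integral_const_mul, g.integral_deriv]
    have := g.map_add_one 0
    rw [zero_add] at this
    rw [this]
    ring
  rw [← g.integral_comp_mul_deriv _ zero_le_one, ← h.integral_comp_mul_deriv _ zero_le_one]
  unfold derivDist
  rw [← intervalIntegral.integral_const_mul M]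
  nth_rewrite 1 [← hη1]
  rw [← intervalIntegral.integral_add i1 i3, ← intervalIntegral.integral_add (i1.add i3) i4,
    ← intervalIntegral.integral_add ((i1.add i3).add i4) i2]
  refine intervalIntegral.integral_mono_ae zero_le_one i5 (((i1.add i3).add i4).add i2) ?_
  filter_upwards [ae_deriv_mul f g, ae_deriv_mul f h] with t h1 h2
  rw [h1, h2]
  have e : deriv f.1 (g.1 t) * deriv g.1 t - deriv f.1 (h.1 t) * deriv h.1 t =
      (deriv f.1 (g.1 t) - c (g.1 t)) * deriv g.1 t + (c (g.1 t) - c (h.1 t)) * deriv g.1 t +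
      c (h.1 t) * (deriv g.1 t - deriv h.1 t) -
      (deriv f.1 (h.1 t) - c (h.1 t)) * deriv h.1 t := by ring
  rw [e]
  refine (abs_sub _ _).trans (add_le_add ((abs_add_le _ _).trans (add_le_add
    ((abs_add_le _ _).trans (add_le_add ?_ ?_)) ?_)) ?_)
  · rw [abs_mul, abs_of_nonneg (g.deriv_nonneg t)]
  · rw [abs_mul, abs_of_nonneg (g.deriv_nonneg t)]
    exact mul_le_mul_of_nonneg_right (hη t) (g.deriv_nonneg t)
  · rw [abs_mul]
    exact mul_le_mul_of_nonneg_right (hM _) (abs_nonneg _)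
  · rw [abs_mul, abs_of_nonneg (h.deriv_nonneg t)]

theorem tendsto_derivDist_mul_left (f h : ACZLoc) :
    Tendsto (fun g : ACZLoc => derivDist (f * g).1 (f * h).1) (𝓝 h) (𝓝 0) := by
  rw [Metric.tendsto_nhds]
  intro ε hε
  -- A window containing the interval from `g(0)` to `g(0) + 1` for every `g` with `|g(0) - h(0)| <
  -- 1`, so one approximation `c` serves all nearby `g`.
  set s := Icc (h.1 0 - 1) (h.1 0 + 2) with hs
  have hψ : Integrable (s.indicator (deriv f.1)) := by
    rw [integrable_indicator_iff measurableSet_Icc]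
    exact (intervalIntegrable_iff_integrableOn_Icc_of_le (by linarith)).1
      (f.intervalIntegrable_deriv _ _)
  obtain ⟨c, hcs, hcε, hcc, hci⟩ :=
    hψ.exists_hasCompactSupport_integral_sub_le (show 0 < ε / 5 by positivity)
  obtain ⟨M, hM⟩ := hcs.exists_bound_of_continuous hcc
  have hM0 : 0 ≤ M := (norm_nonneg _).trans (hM 0)
  obtain ⟨δ, hδ, hδc⟩ := Metric.uniformContinuous_iff.1
    (hcs.uniformContinuous_of_continuous hcc) (ε / 5) (by positivity)
  have hclose : ∀ g : ACZLoc, |g.1 0 - h.1 0| < 1 →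
      ∫ y in g.1 0..g.1 1, |deriv f.1 y - c y| ≤ ε / 5 := by
    intro g hg
    rw [abs_lt] at hg
    have h1 := g.map_add_one 0
    rw [zero_add] at h1
    have hsub : Ioc (g.1 0) (g.1 1) ⊆ s := fun y hy => by
      rw [h1] at hy
      exact ⟨by linarith [hy.1], by linarith [hy.2]⟩
    rw [intervalIntegral.integral_of_le (g.strictMono.monotone zero_le_one)]
    calc ∫ y in Ioc (g.1 0) (g.1 1), |deriv f.1 y - c y|
        = ∫ y in Ioc (g.1 0) (g.1 1), ‖s.indicator (deriv f.1) y - c y‖ := by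
          refine setIntegral_congr_fun measurableSet_Ioc fun y hy => ?_
          simp only [indicator_of_mem (hsub hy), Real.norm_eq_abs]
      _ ≤ ∫ y, ‖s.indicator (deriv f.1) y - c y‖ :=
          setIntegral_le_integral (hψ.sub hci).norm (Eventually.of_forall fun _ => norm_nonneg _)
      _ ≤ ε / 5 := hcε
  -- Each of the four terms of the estimate will be at most `ε / 5`; `M + 1` replaces `M` to avoid
  -- dividing by zero.
  have hr : 0 < min (min 1 δ) (ε / (5 * (M + 1))) := by positivity
  filter_upwards [Metric.ball_mem_nhds h hr] with g hg
  rw [Metric.mem_ball] at hg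
  have hg1 : dist g h < 1 := hg.trans_le ((min_le_left _ _).trans (min_le_left _ _))
  have hgδ : dist g h < δ := hg.trans_le ((min_le_left _ _).trans (min_le_right _ _))
  have hgM : dist g h < ε / (5 * (M + 1)) := hg.trans_le (min_le_right _ _)
  have h1 := derivDist_mul_left_le f g h hcc (η := ε / 5) (M := M) hM (fun x =>
    (hδc ((abs_sub_le_dist g h x).trans_lt hgδ)).le)
  have h2 := hclose g ((abs_sub_le_dist g h 0).trans_lt hg1)
  have h3 := hclose h (by simp)
  have h4 : M * derivDist g.1 h.1 ≤ ε / 5 := by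
    have h5 := (derivDist_le_dist g h).trans hgM.le
    calc M * derivDist g.1 h.1 ≤ (M + 1) * (ε / (5 * (M + 1))) :=
          mul_le_mul (by linarith) h5 (derivDist_nonneg _ _) (by linarith)
      _ = ε / 5 := by field_simp
  rw [Real.dist_eq, sub_zero, abs_of_nonneg (derivDist_nonneg _ _)]
  linarith

theorem tendsto_of_derivDist {ι : Type*} {l : Filter ι} {F : ι → ACZLoc} {f : ACZLoc}
    (h0 : Tendsto (fun i => (F i).1 0) l (𝓝 (f.1 0)))
    (h1 : Tendsto (fun i => derivDist (F i).1 f.1) l (𝓝 0)) : Tendsto F l (𝓝 f) := by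
  rw [tendsto_iff_dist_tendsto_zero]
  have h2 : Tendsto (fun i => |(F i).1 0 - f.1 0| + 2 * derivDist (F i).1 f.1) l (𝓝 0) := by
    have h3 := (h0.sub_const (f.1 0)).abs
    have h4 := h3.add (h1.const_mul 2)
    simpa using h4
  exact squeeze_zero (fun _ => dist_nonneg) (fun i => dist_le (F i) f) h2

theorem continuous_apply (x : ℝ) : Continuous fun f : ACZLoc => f.1 x := by
  rw [Metric.continuous_iff]
  intro f ε hε
  exact ⟨ε, hε, fun g hg => (abs_sub_le_dist g f x).trans_lt hg⟩

theorem continuous_mul_left (f : ACZLoc) : Continuous fun g : ACZLoc => f * g := by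
  rw [continuous_iff_continuousAt]
  intro h
  refine tendsto_of_derivDist ?_ (tendsto_derivDist_mul_left f h)
  exact (f.1.continuous.tendsto _).comp ((continuous_apply 0).tendsto h)

end ACZLoc

/-- A group with a right-invariant pseudometric and continuous left translations is a topological
group. -/
theorem isTopologicalGroup_of_dist_mul_right {G : Type*} [Group G] [PseudoMetricSpace G]
    (hr : ∀ f g h : G, dist (f * h) (g * h) = dist f g)
    (hl : ∀ f : G, Continuous fun g : G => f * g) : IsTopologicalGroup G := by
  have hmul : ContinuousMul G := by
    refine ⟨continuous_iff_continuousAt.2 ?_⟩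
    rintro ⟨f, g⟩
    rw [ContinuousAt, tendsto_iff_dist_tendsto_zero]
    have h1 : Tendsto (fun p : G × G => dist p.1 f) (𝓝 (f, g)) (𝓝 0) :=
      tendsto_iff_dist_tendsto_zero.1 (continuous_fst.tendsto (f, g))
    have h2 : Tendsto (fun p : G × G => dist (f * p.2) (f * g)) (𝓝 (f, g)) (𝓝 0) :=
      tendsto_iff_dist_tendsto_zero.1 (((hl f).comp continuous_snd).tendsto (f, g))
    refine squeeze_zero (fun _ => dist_nonneg) (fun p => ?_) (by simpa using h1.add h2)
    rw [← hr p.1 f p.2]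
    exact dist_triangle _ _ _
  refine { hmul with continuous_inv := continuous_iff_continuousAt.2 fun f => ?_ }
  rw [ContinuousAt, tendsto_iff_dist_tendsto_zero]
  -- Right multiplication by `g` turns the distance from `g⁻¹` to `f⁻¹` into that from 1 to `f⁻¹ *
  -- g`, and left translation by `f⁻¹` is continuous.
  have h1 := tendsto_iff_dist_tendsto_zero.1 ((hl f⁻¹).tendsto f)
  refine h1.congr fun g => ?_
  rw [← hr g⁻¹ f⁻¹ g, inv_mul_cancel, inv_mul_cancel, dist_comm]

instance : IsTopologicalGroup ACZLoc :=
  isTopologicalGroup_of_dist_mul_right ACZLoc.dist_mul_right ACZLoc.continuous_mul_left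

/-! ### Polishness of the group of the line -/

/-- The space `L¹(0,1)`. -/
abbrev UnitL1 : Type := Lp ℝ 1 (volume.restrict (Ioc (0 : ℝ) 1))

theorem polishSpace_unitL1 : PolishSpace UnitL1 := by
  have : Fact ((1 : ENNReal) ≠ ⊤) := ⟨ENNReal.one_ne_top⟩
  infer_instance

namespace ACZLoc

theorem integrable_deriv (f : ACZLoc) : Integrable (deriv f.1) (volume.restrict (Ioc 0 1)) :=
  (intervalIntegrable_iff_integrableOn_Ioc_of_le zero_le_one).1 (f.intervalIntegrable_deriv 0 1)

/-- The derivative of `f` on the unit interval, as an element of `L¹`. -/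
def derivL1 (f : ACZLoc) : UnitL1 := f.integrable_deriv.toL1 _

theorem coeFn_derivL1 (f : ACZLoc) : derivL1 f =ᵐ[volume.restrict (Ioc 0 1)] deriv f.1 :=
  f.integrable_deriv.coeFn_toL1

theorem dist_derivL1_eq_derivDist (f : ACZLoc) {g : ℝ → ℝ} {φ : UnitL1}
    (h : deriv g =ᵐ[volume.restrict (Ioc 0 1)] φ) :
    dist (derivL1 f) φ = derivDist f.1 g := by
  rw [L1.dist_eq_integral_dist, derivDist, intervalIntegral.integral_of_le zero_le_one]
  refine integral_congr_ae ?_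
  filter_upwards [coeFn_derivL1 f, h] with x h1 h2
  rw [h1, ← h2, Real.dist_eq]

theorem dist_derivL1 (f g : ACZLoc) : dist (derivL1 f) (derivL1 g) = derivDist f.1 g.1 :=
  dist_derivL1_eq_derivDist f (coeFn_derivL1 g).symm

theorem continuous_derivL1 : Continuous derivL1 := by
  rw [Metric.continuous_iff]
  intro f ε hε
  refine ⟨ε, hε, fun g hg => ?_⟩
  rw [dist_derivL1]
  exact (derivDist_le_dist g f).trans_lt hg

theorem integral_derivL1 (f : ACZLoc) : ∫ x, derivL1 f x ∂(volume.restrict (Ioc 0 1)) = 1 := by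
  rw [integral_congr_ae (coeFn_derivL1 f), ← intervalIntegral.integral_of_le zero_le_one,
    f.integral_deriv]
  have := f.map_add_one 0
  rw [zero_add] at this
  rw [this]
  ring

/-- Integration is continuous on `L¹`, so the limit density has mass 1 and a primitive commuting
with the unit translation. This primitive need not be injective, since its derivative may vanish on
an interval. -/
theorem exists_limit {F : ℕ → ACZLoc} {a : ℝ} {φ : UnitL1}
    (h0 : Tendsto (fun n => (F n).1 0) atTop (𝓝 a))
    (h1 : Tendsto (fun n => derivL1 (F n)) atTop (𝓝 φ)) :
    ∃ f : ℝ → ℝ, LocallyAbsolutelyContinuous f ∧ (∀ x, f (x + 1) = f x + 1) ∧ f 0 = a ∧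
      deriv f =ᵐ[volume.restrict (Ioc 0 1)] φ ∧
      ∃ r : ℕ → ℝ, Tendsto r atTop (𝓝 0) ∧ ∀ n x, |(F n).1 x - f x| ≤ r n := by
  have hφ : ∫ x, φ x ∂(volume.restrict (Ioc 0 1)) = 1 := by
    have h2 := ((continuous_integral (μ := volume.restrict (Ioc (0 : ℝ) 1)) (G := ℝ)).tendsto
      φ).comp h1
    refine tendsto_nhds_unique h2 ?_
    simp only [Function.comp_def, integral_derivL1]
    exact tendsto_const_nhds
  rw [← intervalIntegral.integral_of_le zero_le_one] at hφ
  obtain ⟨f, hf, hf1, hf0, hfφ⟩ :=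
    exists_locallyAbsolutelyContinuous_deriv_ae_eq (L1.integrable_coeFn φ) hφ a
  refine ⟨f, hf, hf1, hf0, hfφ, fun n => |(F n).1 0 - a| + dist (derivL1 (F n)) φ, ?_, ?_⟩
  · have h2 := (h0.sub_const a).abs.add (tendsto_iff_dist_tendsto_zero.1 h1)
    simpa using h2
  · intro n x
    simp only
    rw [dist_derivL1_eq_derivDist _ hfφ, ← hf0]
    exact abs_sub_le_of_map_add_one (F n).locallyAC hf (F n).map_add_one hf1 x

/-- At the point `(F n)⁻¹ x` the map `F n` takes the value `x`, so `f` takes a value within `r n` of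
`x` there. -/
theorem apply_apply_eq_of_limit {F : ℕ → ACZLoc} {f g : ℝ → ℝ} (hf : Continuous f)
    {r s : ℕ → ℝ} (hr : Tendsto r atTop (𝓝 0)) (hs : Tendsto s atTop (𝓝 0))
    (hF : ∀ n x, |(F n).1 x - f x| ≤ r n) (hG : ∀ n x, |(F n)⁻¹.1 x - g x| ≤ s n) (x : ℝ) :
    f (g x) = x := by
  have h1 : Tendsto (fun n => (F n)⁻¹.1 x) atTop (𝓝 (g x)) := by
    rw [tendsto_iff_dist_tendsto_zero]
    exact squeeze_zero (fun _ => dist_nonneg) (fun n => hG n x) hs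
  have h2 := (hf.tendsto (g x)).comp h1
  have h3 : Tendsto (fun n => f ((F n)⁻¹.1 x)) atTop (𝓝 x) := by
    rw [tendsto_iff_dist_tendsto_zero]
    refine squeeze_zero (fun _ => dist_nonneg) (fun n => ?_) hr
    have := hF n ((F n)⁻¹.1 x)
    rwa [apply_inv_self, abs_sub_comm] at this
  exact tendsto_nhds_unique h2 h3

/-- Convergence of the inverses as well forces the limit to be invertible with absolutely continuous
inverse. -/
theorem exists_eq_of_tendsto {F : ℕ → ACZLoc} {a b : ℝ} {φ ψ : UnitL1}
    (ha : Tendsto (fun n => (F n).1 0) atTop (𝓝 a))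
    (hb : Tendsto (fun n => (F n)⁻¹.1 0) atTop (𝓝 b))
    (hφ : Tendsto (fun n => derivL1 (F n)) atTop (𝓝 φ))
    (hψ : Tendsto (fun n => derivL1 (F n)⁻¹) atTop (𝓝 ψ)) :
    ∃ f : ACZLoc, f.1 0 = a ∧ f⁻¹.1 0 = b ∧ derivL1 f = φ ∧ derivL1 f⁻¹ = ψ := by
  obtain ⟨f, hf, hf1, hf0, hfφ, r, hr, hFr⟩ := exists_limit ha hφ
  obtain ⟨g, hg, hg1, hg0, hgψ, s, hs, hGs⟩ := exists_limit hb hψ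
  have hfg := apply_apply_eq_of_limit hf.continuous hr hs hFr hGs
  have hgf := apply_apply_eq_of_limit (F := fun n => (F n)⁻¹) hg.continuous hs hr hGs
    (by simpa using hFr)
  let e : ℝ ≃ₜ ℝ :=
    { toFun := f
      invFun := g
      left_inv := hgf
      right_inv := hfg
      continuous_toFun := hf.continuous
      continuous_invFun := hg.continuous }
  let E : ACZLoc := ⟨e, map_add_intCast_of_map_add_one hf1, hf, hg⟩
  refine ⟨E, hf0, hg0, ?_, ?_⟩
  · exact Lp.ext ((coeFn_derivL1 E).trans hfφ)
  · exact Lp.ext ((coeFn_derivL1 E⁻¹).trans hgψ)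

/-- The coordinates that exhibit the group as a closed subset of a Polish space. -/
def coords (f : ACZLoc) : (ℝ × UnitL1) × (ℝ × UnitL1) :=
  ((f.1 0, derivL1 f), (f⁻¹.1 0, derivL1 f⁻¹))

theorem isInducing_apply_zero_derivL1 :
    IsInducing fun f : ACZLoc => ((f.1 0, derivL1 f) : ℝ × UnitL1) := by
  refine isInducing_iff_nhds.2 fun f => le_antisymm ?_ ?_
  · exact (((continuous_apply 0).prodMk continuous_derivL1).tendsto f).le_comap
  · have h := tendsto_comap (f := fun f : ACZLoc => ((f.1 0, derivL1 f) : ℝ × UnitL1))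
      (x := 𝓝 (f.1 0, derivL1 f))
    have h1 := (continuous_fst.tendsto (f.1 0, derivL1 f)).comp h
    have h2 := tendsto_iff_dist_tendsto_zero.1
      ((continuous_snd.tendsto (f.1 0, derivL1 f)).comp h)
    refine tendsto_id'.1 (tendsto_of_derivDist (F := id) h1 (h2.congr fun g => ?_))
    exact dist_derivL1 g f

theorem continuous_coords : Continuous coords :=
  ((continuous_apply 0).prodMk continuous_derivL1).prodMk
    (((continuous_apply 0).comp continuous_inv).prodMk (continuous_derivL1.comp continuous_inv))

theorem ext_of_derivL1 {f g : ACZLoc} (h0 : f.1 0 = g.1 0) (h1 : derivL1 f = derivL1 g) :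
    f = g := by
  have h2 := dist_derivL1 f g
  rw [h1, dist_self] at h2
  refine Subtype.ext (Homeomorph.ext fun x => ?_)
  have h3 := abs_sub_le_of_map_add_one f.locallyAC g.locallyAC f.map_add_one g.map_add_one x
  rw [← h2, h0, sub_self, abs_zero, add_zero] at h3
  exact sub_eq_zero.1 (abs_nonpos_iff.1 h3)

theorem isClosed_range_coords : IsClosed (range coords) := by
  refine isClosed_of_closure_subset fun p hp => ?_
  obtain ⟨x, hx, hxp⟩ := mem_closure_iff_seq_limit.1 hp
  choose F hF using hx
  obtain rfl : (fun n => coords (F n)) = x := funext hF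
  obtain ⟨⟨a, φ⟩, ⟨b, ψ⟩⟩ := p
  rw [nhds_prod_eq, nhds_prod_eq, nhds_prod_eq] at hxp
  have h1 := tendsto_prod_iff'.1 hxp
  have h2 := tendsto_prod_iff'.1 h1.1
  have h3 := tendsto_prod_iff'.1 h1.2
  obtain ⟨f, rfl, rfl, rfl, rfl⟩ := exists_eq_of_tendsto h2.1 h3.1 h2.2 h3.2
  exact ⟨f, rfl⟩

/-- The pair `f(0)`, `f'` already induces the topology; the coordinates of the inverse are there to
make the range closed. -/
theorem isClosedEmbedding_coords : IsClosedEmbedding coords := by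
  refine ⟨⟨?_, fun f g h => ?_⟩, isClosed_range_coords⟩
  · refine IsInducing.of_comp (g := Prod.fst) continuous_coords continuous_fst ?_
    exact isInducing_apply_zero_derivL1
  · have h1 := congrArg Prod.fst h
    exact ext_of_derivL1 (congrArg Prod.fst h1) (congrArg Prod.snd h1)

end ACZLoc

theorem isPolishGroup_acZLoc : IsPolishGroup ACZLoc := by
  have := polishSpace_unitL1
  exact ⟨inferInstance, ACZLoc.isClosedEmbedding_coords.polishSpace⟩

/-! ### Linear paths to the identity -/

namespace ACZLoc

/-- The convex combination of the identity and `f`, as a function. -/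
def interpFun (f : ACZLoc) (t x : ℝ) : ℝ := (1 - t) * x + t * f.1 x

section Interp

variable (f : ACZLoc) {t : ℝ}

theorem interpFun_add_one (t x : ℝ) : interpFun f t (x + 1) = interpFun f t x + 1 := by
  simp only [interpFun, f.map_add_one]
  ring

theorem locallyAC_interpFun (t : ℝ) : LocallyAbsolutelyContinuous (interpFun f t) := fun a b =>
  ((lipschitz_locallyAbsolutelyContinuous LipschitzWith.id a b).const_mul (1 - t)).add
    ((f.locallyAC a b).const_mul t)

theorem mul_sub_le_interpFun_sub (ht : 0 ≤ t) {x y : ℝ} (hxy : x ≤ y) :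
    (1 - t) * (y - x) ≤ interpFun f t y - interpFun f t x := by
  have h := mul_le_mul_of_nonneg_left (f.strictMono.monotone hxy) ht
  simp only [interpFun]
  linarith

theorem strictMono_interpFun (ht : 0 ≤ t) (ht1 : t < 1) : StrictMono (interpFun f t) := by
  intro x y hxy
  have h1 := mul_sub_le_interpFun_sub f ht hxy.le
  have h2 : 0 < (1 - t) * (y - x) := mul_pos (by linarith) (by linarith)
  linarith

theorem surjective_interpFun (t : ℝ) : Function.Surjective (interpFun f t) := by
  have hz : ∀ n : ℤ, interpFun f t n = interpFun f t 0 + n := fun n => by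
    have := map_add_intCast_of_map_add_one (interpFun_add_one f t) 0 n
    rwa [zero_add] at this
  refine fun y => ?_
  set c := interpFun f t 0
  have h1 : (⌊y - c⌋ : ℝ) ≤ y - c := Int.floor_le _
  have h2 : y - c < ⌊y - c⌋ + 1 := Int.lt_floor_add_one _
  have h3 := hz ⌊y - c⌋
  have h4 := interpFun_add_one f t ⌊y - c⌋
  have h5 := intermediate_value_Icc (show (⌊y - c⌋ : ℝ) ≤ ⌊y - c⌋ + 1 by linarith)
    (locallyAC_interpFun f t).continuous.continuousOn
  obtain ⟨x, -, hx⟩ := h5 (show y ∈ _ from ⟨by linarith, by linarith⟩)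
  exact ⟨x, hx⟩

/-- The convex combination of the identity and `f`, for `t < 1`. -/
def interpLT (ht : 0 ≤ t) (ht1 : t < 1) : ACZLoc := by
  let e := ((strictMono_interpFun f ht ht1).orderIsoOfSurjective _
    (surjective_interpFun f t)).toHomeomorph
  refine ⟨e, map_add_intCast_of_map_add_one (interpFun_add_one f t), locallyAC_interpFun f t, ?_⟩
  have hpos : 0 < 1 - t := by linarith
  -- The interpolation has slope at least `1 - t`, so its inverse is Lipschitz. The bound
  -- degenerates at `t = 1`, where `f` itself has to be used.
  have hlip : LipschitzWith (Real.toNNReal (1 - t)⁻¹) (e⁻¹ : ℝ ≃ₜ ℝ) := by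
    have hle : ∀ x y : ℝ, x ≤ y → dist (e.symm x) (e.symm y) ≤ (1 - t)⁻¹ * dist x y := by
      intro x y hxy
      have hm : e.symm x ≤ e.symm y := by
        by_contra h
        have h1 := strictMono_interpFun f ht ht1 (not_le.1 h)
        have h2 : interpFun f t (e.symm y) = y := e.apply_symm_apply y
        have h3 : interpFun f t (e.symm x) = x := e.apply_symm_apply x
        linarith
      have h1 := mul_sub_le_interpFun_sub f ht hm
      have h2 : interpFun f t (e.symm y) = y := e.apply_symm_apply y
      have h3 : interpFun f t (e.symm x) = x := e.apply_symm_apply x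
      rw [h2, h3] at h1
      rw [dist_comm, Real.dist_eq, abs_of_nonneg (by linarith), dist_comm, Real.dist_eq,
        abs_of_nonneg (by linarith), ← div_eq_inv_mul, le_div_iff₀ hpos]
      linarith
    refine LipschitzWith.of_dist_le_mul fun x y => ?_
    rw [Real.coe_toNNReal _ (inv_nonneg.2 hpos.le)]
    rcases le_total x y with h | h
    · exact hle x y h
    · rw [dist_comm x y, dist_comm]
      exact hle y x h
  exact fun a b => hlip.lipschitzOnWith.absolutelyContinuousOnInterval

open Classical in
/-- The convex combination of the identity and `f`; it is `f` for `t ≥ 1`. -/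
def interp (t : ℝ) : ACZLoc :=
  if h : 0 ≤ t ∧ t < 1 then interpLT f h.1 h.2 else f

theorem interp_apply (ht : 0 ≤ t) (ht1 : t ≤ 1) (x : ℝ) :
    (interp f t).1 x = interpFun f t x := by
  unfold interp
  split_ifs with h
  · rfl
  · obtain rfl : t = 1 := le_antisymm ht1 (not_lt.1 fun h' => h ⟨ht, h'⟩)
    simp [interpFun]

theorem interp_one : interp f 1 = f := by
  simp [interp]

theorem interp_zero : interp f 0 = 1 := by
  refine Subtype.ext (Homeomorph.ext fun x => ?_)
  rw [interp_apply f le_rfl zero_le_one]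
  simp [interpFun]

/-- Both derivatives are nonnegative of mass 1. The bound does not depend on `f`, so only the
displacement of the origin can be large. -/
theorem derivDist_one_le_two : derivDist f.1 (1 : ACZLoc).1 ≤ 2 := by
  have i1 := f.intervalIntegrable_deriv 0 1
  have i2 := (1 : ACZLoc).intervalIntegrable_deriv 0 1
  have h : derivDist f.1 (1 : ACZLoc).1 ≤
      ∫ t in (0 : ℝ)..1, (deriv f.1 t + deriv (1 : ACZLoc).1 t) :=
    intervalIntegral.integral_mono_on zero_le_one (i1.sub i2).abs (i1.add i2) fun x _ =>
      (abs_sub _ _).trans_eq (by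
        rw [abs_of_nonneg (f.deriv_nonneg x), abs_of_nonneg ((1 : ACZLoc).deriv_nonneg x)])
  rw [intervalIntegral.integral_add i1 i2, integral_deriv, integral_deriv] at h
  have h1 := f.map_add_one 0
  rw [zero_add] at h1
  rw [h1] at h
  simp only [one_apply] at h
  linarith

theorem derivDist_interp {s : ℝ} (hs : 0 ≤ s) (hs1 : s ≤ 1) (ht : 0 ≤ t) (ht1 : t ≤ 1) :
    derivDist (interp f s).1 (interp f t).1 = |s - t| * derivDist f.1 (1 : ACZLoc).1 := by
  unfold derivDist
  rw [← intervalIntegral.integral_const_mul]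
  refine intervalIntegral.integral_congr_ae ?_
  filter_upwards [f.ae_hasDerivAt, (1 : ACZLoc).ae_hasDerivAt] with x hx hx1 _
  have key : ∀ r : ℝ, 0 ≤ r → r ≤ 1 →
      deriv (interp f r).1 x = (1 - r) * deriv (1 : ACZLoc).1 x + r * deriv f.1 x := by
    intro r hr hr1
    have : ((interp f r).1 : ℝ → ℝ) = fun x => (1 - r) * (1 : ACZLoc).1 x + r * f.1 x :=
      funext fun x => interp_apply f hr hr1 x
    rw [this]
    exact ((hx1.const_mul (1 - r)).add (hx.const_mul r)).deriv
  rw [key s hs hs1, key t ht ht1, ← abs_mul]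
  congr 1
  ring

theorem dist_interp_le {s : ℝ} (hs : 0 ≤ s) (hs1 : s ≤ 1) (ht : 0 ≤ t) (ht1 : t ≤ 1) :
    dist (interp f s) (interp f t) ≤ |s - t| * (|f.1 0| + 4) := by
  refine (dist_le _ _).trans ?_
  have h1 := derivDist_interp f hs hs1 ht ht1
  have h2 := derivDist_one_le_two f
  have h3 : (interp f s).1 0 - (interp f t).1 0 = (s - t) * f.1 0 := by
    rw [interp_apply f hs hs1, interp_apply f ht ht1]
    simp only [interpFun]
    ring
  rw [h1, h3, abs_mul]
  have h4 := mul_le_mul_of_nonneg_left h2 (abs_nonneg (s - t))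
  linarith

end Interp

/-- Homeomorphisms of bounded displacement at the origin are products of boundedly many elements
close to the identity, with factors taken along the linear path to the identity. -/
theorem exists_nat_dist_interp_lt (C : ℝ) {ε : ℝ} (hε : 0 < ε) :
    ∃ n : ℕ, 0 < n ∧ ∀ f : ACZLoc, |f.1 0| ≤ C → ∀ i < n,
      dist (interp f ((i + 1 : ℕ) / n : ℝ) * (interp f (i / n : ℝ))⁻¹) 1 < ε := by
  -- Each of the `n` steps has length at most `(C + 4) / n`; the maximum with 0 keeps `n` positive
  -- when `C + 4` is not.
  obtain ⟨n, hn⟩ := exists_nat_gt (max ((C + 4) / ε) 0)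
  have hn0 : (0 : ℝ) < n := (le_max_right _ _).trans_lt hn
  have hnC : (C + 4) / ε < n := (le_max_left _ _).trans_lt hn
  rw [div_lt_iff₀ hε] at hnC
  refine ⟨n, by exact_mod_cast hn0, fun f hf i hi => ?_⟩
  have h1 : ((i + 1 : ℕ) : ℝ) ≤ n := by exact_mod_cast hi
  have h2 : (i : ℝ) ≤ n := by exact_mod_cast hi.le
  rw [← dist_mul_right _ 1 (interp f (i / n)), inv_mul_cancel_right, one_mul]
  refine (dist_interp_le f (by positivity) (div_le_one_of_le₀ h1 hn0.le) (by positivity)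
    (div_le_one_of_le₀ h2 hn0.le)).trans_lt ?_
  have h3 : ((i + 1 : ℕ) : ℝ) / n - i / n = 1 / n := by
    push_cast
    ring
  rw [h3, abs_of_pos (by positivity), one_div, ← div_eq_inv_mul, div_lt_iff₀ hn0]
  linarith

end ACZLoc

/-- The endpoint of a path of `n` steps with quotients in `V` lies in `V ^ n`. -/
theorem mem_pow_of_path {G : Type*} [Group G] {V : Set G} {γ : ℕ → G} (h0 : γ 0 = 1) (n : ℕ)
    (h : ∀ i < n, γ (i + 1) * (γ i)⁻¹ ∈ V) : γ n ∈ V ^ n := by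
  induction n with
  | zero => simp [h0]
  | succ n ih =>
    rw [pow_succ', ← inv_mul_cancel_right (γ (n + 1)) (γ n)]
    exact mul_mem_mul (h n (Nat.lt_succ_self n)) (ih fun i hi => h i (hi.trans (Nat.lt_succ_self n)))

/-! ### A coarsely bounded generating set of the group of the line -/

namespace ACZLoc

/-- The homeomorphisms that displace the origin by at most one. -/
def smallDisplacement : Set ACZLoc := {f | |f.1 0| ≤ 1}

theorem exists_smallDisplacement_subset_pow {V : Set ACZLoc} (hV : V ∈ 𝓝 (1 : ACZLoc)) :
    ∃ k : ℕ, smallDisplacement ⊆ V ^ k := by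
  obtain ⟨ε, hε, hs⟩ := Metric.mem_nhds_iff.1 hV
  obtain ⟨n, hn, h⟩ := exists_nat_dist_interp_lt 1 hε
  refine ⟨n, fun f hf => ?_⟩
  have h1 := mem_pow_of_path (V := V) (γ := fun i : ℕ => interp f (i / n))
    (by simp [interp_zero]) n (fun i hi => hs (h f hf i hi))
  have hn0 : (n : ℝ) ≠ 0 := by exact_mod_cast hn.ne'
  simpa only [div_self hn0, interp_one] using h1

theorem integerTranslation_apply (n : Multiplicative ℤ) (x : ℝ) :
    (integerTranslation n).1 x = x + (Multiplicative.toAdd n : ℤ) := rfl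

theorem integerTranslation_mul (m n : Multiplicative ℤ) :
    integerTranslation (m * n) = integerTranslation m * integerTranslation n := by
  refine Subtype.ext (Homeomorph.ext fun x => ?_)
  rw [mul_apply, integerTranslation_apply, integerTranslation_apply, integerTranslation_apply,
    toAdd_mul]
  push_cast
  ring

theorem integerTranslation_one : integerTranslation 1 = 1 :=
  Subtype.ext (Homeomorph.ext fun x => by rw [integerTranslation_apply]; simp)

theorem integerTranslation_inv (m : Multiplicative ℤ) :
    integerTranslation m⁻¹ = (integerTranslation m)⁻¹ := by
  rw [eq_inv_iff_mul_eq_one, ← integerTranslation_mul, inv_mul_cancel, integerTranslation_one]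

/-- The integer translations, as a homomorphism. -/
def translationHom : Multiplicative ℤ →* ACZLoc where
  toFun := integerTranslation
  map_one' := integerTranslation_one
  map_mul' := integerTranslation_mul

theorem inv_translation_floor_mul_mem (f : ACZLoc) :
    (integerTranslation (Multiplicative.ofAdd ⌊f.1 0⌋))⁻¹ * f ∈ smallDisplacement := by
  rw [← integerTranslation_inv]
  change |(integerTranslation (Multiplicative.ofAdd ⌊f.1 0⌋)⁻¹).1 (f.1 0)| ≤ 1
  rw [integerTranslation_apply]
  have h1 := Int.floor_le (f.1 0)
  have h2 := Int.lt_floor_add_one (f.1 0)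
  simp only [toAdd_inv, toAdd_ofAdd, Int.cast_neg]
  rw [abs_le]
  constructor <;> linarith

theorem translation_mem_closure (n : Multiplicative ℤ) :
    integerTranslation n ∈ Subgroup.closure smallDisplacement := by
  have h1 : integerTranslation (Multiplicative.ofAdd 1) ∈ Subgroup.closure smallDisplacement :=
    Subgroup.subset_closure (by
      change |(integerTranslation (Multiplicative.ofAdd 1)).1 0| ≤ 1
      rw [integerTranslation_apply]
      simp)
  have h2 : n = (Multiplicative.ofAdd 1) ^ (Multiplicative.toAdd n) := by
    rw [← ofAdd_zsmul]
    simp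
  have h3 : integerTranslation n =
      (integerTranslation (Multiplicative.ofAdd 1)) ^ (Multiplicative.toAdd n) := by
    conv_lhs => rw [h2]
    exact map_zpow translationHom _ _
  rw [h3]
  exact Subgroup.zpow_mem _ h1 _

/-- Removing the integer part of `f(0)` by a translation leaves a small displacement, and the
translation by 1 itself has small displacement. -/
theorem isCoarseGeneratingSet_smallDisplacement : IsCoarseGeneratingSet smallDisplacement := by
  refine ⟨?_, ?_, ?_⟩
  · exact isClosed_le (continuous_apply 0).abs continuous_const
  · exact isCoarselyBounded_of_forall_subset_pow fun _ => exists_smallDisplacement_subset_pow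
  · refine (Subgroup.eq_top_iff' _).2 fun f => ?_
    have h := Subgroup.mul_mem _ (translation_mem_closure (Multiplicative.ofAdd ⌊f.1 0⌋))
      (Subgroup.subset_closure (inv_translation_floor_mul_mem f))
    rwa [mul_inv_cancel_left] at h

theorem isCompatibleNorm : IsCompatibleNorm fun f : ACZLoc => dist f 1 :=
  isCompatibleNorm_dist_one dist_mul_right

end ACZLoc

/-! ### The integers as a Polish group -/

section Integers

/-- The standard generating set of the integers. -/
def intGenerator : Set (Multiplicative ℤ) := {Multiplicative.ofAdd 1}

theorem isCompatibleNorm_int :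
    IsCompatibleNorm fun n : Multiplicative ℤ => |((Multiplicative.toAdd n : ℤ) : ℝ)| where
  one := by simp
  inv n := by simp
  mul_le m n := by
    rw [toAdd_mul]
    push_cast
    exact abs_add_le _ _
  basis := by
    rw [nhds_discrete]
    refine ⟨fun s => ⟨fun hs => ⟨1, one_pos, fun n hn => ?_⟩, ?_⟩⟩
    · have h1 : |((Multiplicative.toAdd n : ℤ) : ℝ)| < 1 := hn
      have h2 : |Multiplicative.toAdd n| < 1 := by exact_mod_cast h1
      rw [Int.abs_lt_one_iff] at h2
      have h3 : n = 1 := by rw [← ofAdd_toAdd n, h2, ofAdd_zero]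
      rw [h3]
      exact hs
    · rintro ⟨ε, hε, hs⟩
      exact hs (by simpa using hε)

theorem isPolishGroup_int : IsPolishGroup (Multiplicative ℤ) :=
  ⟨inferInstance, inferInstance⟩

theorem mem_intGenerator_pow (z : Multiplicative ℤ) :
    z ∈ (intGenerator ∪ intGenerator⁻¹) ^ (Multiplicative.toAdd z).natAbs := by
  have h1 : z = (Multiplicative.ofAdd 1) ^ (Multiplicative.toAdd z) := by
    rw [← ofAdd_zsmul]
    simp
  rcases Int.natAbs_eq (Multiplicative.toAdd z) with h | h
  · have h2 : (Multiplicative.ofAdd 1) ^ (Multiplicative.toAdd z).natAbs = z := by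
      rw [← zpow_natCast, ← h, ← h1]
    have h3 := Set.pow_mem_pow (n := (Multiplicative.toAdd z).natAbs)
      (show Multiplicative.ofAdd 1 ∈ intGenerator ∪ intGenerator⁻¹ from Or.inl rfl)
    rwa [h2] at h3
  · have h2 : (Multiplicative.ofAdd 1)⁻¹ ^ (Multiplicative.toAdd z).natAbs = z := by
      rw [inv_pow, ← zpow_natCast, ← zpow_neg, ← h, ← h1]
    have h3 := Set.pow_mem_pow (n := (Multiplicative.toAdd z).natAbs)
      (show (Multiplicative.ofAdd 1)⁻¹ ∈ intGenerator ∪ intGenerator⁻¹ from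
        Or.inr (inv_mem_inv.2 rfl))
    rwa [h2] at h3

theorem isCoarseGeneratingSet_intGenerator : IsCoarseGeneratingSet intGenerator := by
  refine ⟨isClosed_discrete _, ?_, ?_⟩
  · intro m _ _
    refine ⟨0, ?_⟩
    rintro x rfl y rfl
    exact (m.dist_self _).le
  · refine (Subgroup.eq_top_iff' _).2 fun z => ?_
    have h1 : z = (Multiplicative.ofAdd 1) ^ (Multiplicative.toAdd z) := by
      rw [← ofAdd_zsmul]
      simp
    have h2 : Multiplicative.ofAdd 1 ∈ Subgroup.closure intGenerator :=
      Subgroup.subset_closure (mem_singleton _)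
    rw [h1]
    exact Subgroup.zpow_mem _ h2 _

end Integers

/-! ### Integer translations form a quasi-isometry -/

namespace ACZLoc

/-- By equivariance `x` may be taken in `[0, 1)`, where monotonicity confines `f(x)` between `f(0)`
and `f(0) + 1`. -/
theorem abs_apply_sub_le_of_mem {f : ACZLoc} (hf : f ∈ smallDisplacement) (x : ℝ) :
    |f.1 x - x| ≤ 2 := by
  have h0 := abs_le.1 (show |f.1 0| ≤ 1 from hf)
  have h1 := f.map_add_intCast (Int.fract x) ⌊x⌋
  rw [Int.fract_add_floor] at h1
  have h2 := Int.fract_nonneg x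
  have h3 := Int.fract_lt_one x
  have h4 := f.strictMono.monotone h2
  have h5 := f.strictMono h3
  have h6 := f.map_add_one 0
  rw [zero_add] at h6
  have h7 := Int.fract_add_floor x
  rw [abs_le]
  constructor <;> linarith

theorem abs_apply_sub_le_of_mem_pow {k : ℕ} {f : ACZLoc}
    (hf : f ∈ (smallDisplacement ∪ smallDisplacement⁻¹) ^ k) (x : ℝ) :
    |f.1 x - x| ≤ 2 * k := by
  induction k generalizing f x with
  | zero =>
    rw [pow_zero, Set.mem_one] at hf
    simp [hf]
  | succ k ih =>
    rw [pow_succ] at hf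
    obtain ⟨g, hg, h, hh, rfl⟩ := Set.mem_mul.1 hf
    have h1 := ih hg (h.1 x)
    have h2 : |h.1 x - x| ≤ 2 := by
      rcases hh with hh | hh
      · exact abs_apply_sub_le_of_mem hh x
      · have := abs_apply_sub_le_of_mem hh (h.1 x)
        rwa [inv_apply_self, abs_sub_comm] at this
    rw [mul_apply]
    have h3 := abs_sub_le (g.1 (h.1 x)) (h.1 x) x
    push_cast
    linarith

theorem isQuasiIsometry_integerTranslation :
    IsQuasiIsometry (wordMetric intGenerator) (wordMetric smallDisplacement)
      integerTranslation := by
  have hB := isCoarseGeneratingSet_smallDisplacement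
  have hZ := isCoarseGeneratingSet_intGenerator
  have hmul : ∀ m n : Multiplicative ℤ,
      (integerTranslation m)⁻¹ * integerTranslation n = integerTranslation (m⁻¹ * n) := by
    intro m n
    rw [integerTranslation_mul, integerTranslation_inv]
  -- The factor 2 is the largest displacement caused by one generator; the additive 1 is needed only
  -- because `f` is one generator away from the translation by `⌊f(0)⌋`.
  refine ⟨2, one_le_two, 1, zero_le_one, fun m n => ⟨?_, ?_⟩, fun f => ?_⟩
  · obtain ⟨k, hk, hk'⟩ := exists_wordMetric_eq hB.2.2 (integerTranslation m)
      (integerTranslation n)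
    have h1 := wordMetric_le (pow_subset_pow_left (subset_insert 1 _)
      (mem_intGenerator_pow (m⁻¹ * n)))
    rw [hmul] at hk'
    have h2 := abs_apply_sub_le_of_mem_pow hk' 0
    rw [integerTranslation_apply, zero_add, sub_zero, ← Int.cast_abs, ← Nat.cast_natAbs] at h2
    have h3 : (((Multiplicative.toAdd (m⁻¹ * n)).natAbs : ℕ) : ℝ) ≤ 2 * k := by exact_mod_cast h2
    rw [hk]
    linarith
  · obtain ⟨k, hk, hk'⟩ := exists_wordMetric_eq hZ.2.2 m n
    have hsub : translationHom '' (intGenerator ∪ intGenerator⁻¹) ⊆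
        smallDisplacement ∪ smallDisplacement⁻¹ := by
      have hgen : translationHom (Multiplicative.ofAdd 1) ∈ smallDisplacement := by
        change |(integerTranslation (Multiplicative.ofAdd 1)).1 0| ≤ 1
        rw [integerTranslation_apply]
        simp
      rintro _ ⟨z, hz | hz, rfl⟩
      · obtain rfl : z = Multiplicative.ofAdd 1 := hz
        exact Or.inl hgen
      · have hz' : z⁻¹ = Multiplicative.ofAdd 1 := hz
        refine Or.inr ?_
        rw [Set.mem_inv, ← map_inv, hz']
        exact hgen
    have h1 : integerTranslation (m⁻¹ * n) ∈
        (smallDisplacement ∪ smallDisplacement⁻¹) ^ k := by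
      refine pow_subset_pow_left hsub ?_
      rw [← Set.image_pow]
      exact ⟨_, hk', rfl⟩
    rw [← hmul] at h1
    have h2 := wordMetric_le (pow_subset_pow_left (subset_insert 1 _) h1)
    rw [hk]
    linarith [Nat.cast_nonneg (α := ℝ) k]
  · refine ⟨Multiplicative.ofAdd ⌊f.1 0⌋, ?_⟩
    have h1 := wordMetric_le (S := smallDisplacement)
      (x := integerTranslation (Multiplicative.ofAdd ⌊f.1 0⌋)) (y := f) (k := 1) (by
        rw [pow_one]
        exact mem_insert_of_mem _ (Or.inl (inv_translation_floor_mul_mem f)))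
    simpa using h1

theorem isPolishQuasiIsometry_integerTranslation : IsPolishQuasiIsometry integerTranslation :=
  isPolishQuasiIsometry_of_wordMetric isPolishGroup_int isPolishGroup_acZLoc
    isCompatibleNorm_int isCompatibleNorm isCoarseGeneratingSet_intGenerator
    isCoarseGeneratingSet_smallDisplacement isQuasiIsometry_integerTranslation

end ACZLoc

/-! ### The group of the interval as the stabiliser of the origin -/

theorem AbsolutelyContinuousOnInterval.congr_of_eqOn {f g : ℝ → ℝ} {a b : ℝ}
    (hf : AbsolutelyContinuousOnInterval f a b) (h : EqOn f g (uIcc a b)) :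
    AbsolutelyContinuousOnInterval g a b := by
  rw [absolutelyContinuousOnInterval_iff] at *
  intro ε hε
  obtain ⟨δ, hδ, h1⟩ := hf ε hε
  refine ⟨δ, hδ, fun E hE hlen => ?_⟩
  have h2 := h1 E hE hlen
  refine lt_of_eq_of_lt (Finset.sum_congr rfl fun i hi => ?_) h2
  rw [h (hE.1 i hi).1, h (hE.1 i hi).2]

theorem derivDist_congr_of_eqOn {f g f' g' : ℝ → ℝ} (hf : EqOn f f' (Icc 0 1))
    (hg : EqOn g g' (Icc 0 1)) : derivDist f g = derivDist f' g' := by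
  have key : ∀ {u v : ℝ → ℝ}, EqOn u v (Icc 0 1) → ∀ x ∈ Ioo (0 : ℝ) 1, deriv u x = deriv v x :=
    fun huv x hx => Filter.EventuallyEq.deriv_eq
      (Filter.eventuallyEq_of_mem (Icc_mem_nhds hx.1 hx.2) huv)
  unfold derivDist
  refine intervalIntegral.integral_congr_ae ?_
  -- Equality on `[0, 1]` determines derivatives only in the interior; at 1 they may differ.
  have h1 : ∀ᵐ x : ℝ, x ≠ 1 := by simp [ae_iff]
  filter_upwards [h1] with x hx hx'
  rw [uIoc_of_le zero_le_one] at hx'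
  have hx'' : x ∈ Ioo (0 : ℝ) 1 := ⟨hx'.1, lt_of_le_of_ne hx'.2 hx⟩
  rw [key hf x hx'', key hg x hx'']

namespace ACI

theorem extendI_apply (f : unitInterval ≃ₜ unitInterval) {x : ℝ} (hx : x ∈ Icc (0 : ℝ) 1) :
    extendI f x = f ⟨x, hx⟩ := by
  simp [extendI, IccExtend_of_mem _ _ hx]

theorem extendI_mem_Icc (f : unitInterval ≃ₜ unitInterval) (x : ℝ) :
    extendI f x ∈ Icc (0 : ℝ) 1 := by
  simpa using extendI_mem f x

theorem extendI_inv_extendI (f : unitInterval ≃ₜ unitInterval) {x : ℝ} (hx : x ∈ Icc (0 : ℝ) 1) :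
    extendI f⁻¹ (extendI f x) = x := by
  have h : extendI (f⁻¹ * f) x = extendI f⁻¹ (extendI f x) := congrFun (extendI_mul f⁻¹ f) x
  rw [← h, inv_mul_cancel, extendI_apply _ hx]
  rfl

theorem extendI_strictMonoOn {f : unitInterval ≃ₜ unitInterval} (hf : StrictMono f) :
    StrictMonoOn (extendI f) (Icc 0 1) := by
  intro x hx y hy hxy
  rw [extendI_apply f hx, extendI_apply f hy]
  exact hf (show (⟨x, hx⟩ : unitInterval) < ⟨y, hy⟩ from hxy)

theorem extendI_zero {f : unitInterval ≃ₜ unitInterval} (hf : StrictMono f) :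
    extendI f 0 = 0 := by
  have h0 : (0 : ℝ) ∈ Icc (0 : ℝ) 1 := ⟨le_rfl, zero_le_one⟩
  have h1 := extendI_inv_extendI f⁻¹ h0
  rw [inv_inv] at h1
  refine le_antisymm ?_ (extendI_mem_Icc f 0).1
  conv_rhs => rw [← h1]
  exact extendI_monotone hf (extendI_mem_Icc f⁻¹ 0).1

theorem extendI_one {f : unitInterval ≃ₜ unitInterval} (hf : StrictMono f) :
    extendI f 1 = 1 := by
  have h0 : (1 : ℝ) ∈ Icc (0 : ℝ) 1 := ⟨zero_le_one, le_rfl⟩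
  have h1 := extendI_inv_extendI f⁻¹ h0
  rw [inv_inv] at h1
  refine le_antisymm (extendI_mem_Icc f 1).2 ?_
  conv_lhs => rw [← h1]
  exact extendI_monotone hf (extendI_mem_Icc f⁻¹ 1).2

/-- The extension of a self-map of the unit interval commuting with integer translations. -/
def periodicExt (f : unitInterval ≃ₜ unitInterval) (x : ℝ) : ℝ :=
  ⌊x⌋ + extendI f (Int.fract x)

theorem periodicExt_add_one (f : unitInterval ≃ₜ unitInterval) (x : ℝ) :
    periodicExt f (x + 1) = periodicExt f x + 1 := by
  simp only [periodicExt, Int.floor_add_one, Int.fract_add_one]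
  push_cast
  ring

theorem periodicExt_eqOn {f : unitInterval ≃ₜ unitInterval} (hf : StrictMono f) :
    EqOn (extendI f) (periodicExt f) (Icc 0 1) := by
  intro x hx
  rcases hx.2.lt_or_eq with h | rfl
  · simp [periodicExt, Int.floor_eq_zero_iff.2 ⟨hx.1, h⟩, Int.fract_eq_self.2 ⟨hx.1, h⟩]
  · simp [periodicExt, extendI_zero hf, extendI_one hf]

theorem extendI_fract_mem_Ico {f : unitInterval ≃ₜ unitInterval} (hf : StrictMono f) (x : ℝ) :
    extendI f (Int.fract x) ∈ Ico (0 : ℝ) 1 := by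
  refine ⟨(extendI_mem_Icc f _).1, ?_⟩
  rw [← extendI_one hf]
  exact extendI_strictMonoOn hf ⟨Int.fract_nonneg x, (Int.fract_lt_one x).le⟩
    ⟨zero_le_one, le_rfl⟩ (Int.fract_lt_one x)

theorem periodicExt_mul {f g : unitInterval ≃ₜ unitInterval} (hg : StrictMono g) (x : ℝ) :
    periodicExt (f * g) x = periodicExt f (periodicExt g x) := by
  have h := extendI_fract_mem_Ico hg x
  have h1 : ⌊periodicExt g x⌋ = ⌊x⌋ := by
    rw [periodicExt, Int.floor_intCast_add, Int.floor_eq_zero_iff.2 h, add_zero]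
  have h2 : Int.fract (periodicExt g x) = extendI g (Int.fract x) := by
    rw [periodicExt, Int.fract_intCast_add, Int.fract_eq_self.2 h]
  rw [periodicExt, extendI_mul]
  conv_rhs => rw [periodicExt, h1, h2]

theorem periodicExt_one (x : ℝ) : periodicExt 1 x = x := by
  rw [periodicExt, extendI_apply 1 ⟨Int.fract_nonneg x, (Int.fract_lt_one x).le⟩]
  exact Int.floor_add_fract x

theorem locallyAC_periodicExt {f : unitInterval ≃ₜ unitInterval} (hf : StrictMono f)
    (hac : AbsolutelyContinuousI f) : LocallyAbsolutelyContinuous (periodicExt f) := by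
  refine locallyAbsolutelyContinuous_of_map_add_one (hac.congr_of_eqOn ?_) (periodicExt_add_one f)
  rw [uIcc_of_le zero_le_one]
  exact periodicExt_eqOn hf

/-- The homeomorphism of the line induced by an element of `AC₊(I)`. -/
def toACZLoc (f : ACI) : ACZLoc := by
  have h1 := locallyAC_periodicExt f.2.1 f.2.2.1
  have h2 := locallyAC_periodicExt (f⁻¹).2.1 (f⁻¹).2.2.1
  exact ⟨{
    toFun := periodicExt f.1
    invFun := periodicExt f.1⁻¹
    left_inv := fun x => by rw [← periodicExt_mul f.2.1, inv_mul_cancel, periodicExt_one]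
    right_inv := fun x => by
      rw [← periodicExt_mul (strictMono_inv f.2.1), mul_inv_cancel, periodicExt_one]
    continuous_toFun := h1.continuous
    continuous_invFun := h2.continuous },
    map_add_intCast_of_map_add_one (periodicExt_add_one f.1), h1, h2⟩

/-- The embedding of `AC₊(I)` into `AC_ℤ^loc(ℝ)`. -/
def toACZLocHom : ACI →* ACZLoc :=
  MonoidHom.mk' toACZLoc fun _ g => Subtype.ext (Homeomorph.ext fun x => periodicExt_mul g.2.1 x)

theorem toACZLocHom_apply (f : ACI) (x : ℝ) : (toACZLocHom f).1 x = periodicExt f.1 x := rfl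

theorem toACZLocHom_apply_zero (f : ACI) : (toACZLocHom f).1 0 = 0 := by
  rw [toACZLocHom_apply, ← periodicExt_eqOn f.2.1 ⟨le_rfl, zero_le_one⟩, extendI_zero f.2.1]

theorem dist_eq_derivDist (f g : ACI) :
    dist f g = derivDist (toACZLocHom f).1 (toACZLocHom g).1 :=
  derivDist_congr_of_eqOn (periodicExt_eqOn f.2.1) (periodicExt_eqOn g.2.1)

theorem dist_le_dist (f g : ACI) : dist f g ≤ dist (toACZLocHom f) (toACZLocHom g) :=
  (dist_eq_derivDist f g).trans_le (ACZLoc.derivDist_le_dist _ _)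

theorem dist_toACZLocHom_le (f g : ACI) : dist (toACZLocHom f) (toACZLocHom g) ≤ 2 * dist f g := by
  refine (ACZLoc.dist_le _ _).trans_eq ?_
  rw [toACZLocHom_apply_zero, toACZLocHom_apply_zero, dist_eq_derivDist]
  simp

theorem isInducing_toACZLocHom : IsInducing toACZLocHom := by
  have h1 : LipschitzWith 2 toACZLocHom := LipschitzWith.of_dist_le_mul dist_toACZLocHom_le
  have h2 : AntilipschitzWith 1 toACZLocHom := AntilipschitzWith.of_le_mul_dist fun f g => by
    rw [NNReal.coe_one, one_mul]
    exact dist_le_dist f g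
  exact (h2.isUniformInducing h1.uniformContinuous).isInducing

theorem apply_mem_Icc_of_fixes_zero {F : ACZLoc} (hF : F.1 0 = 0) {x : ℝ}
    (hx : x ∈ Icc (0 : ℝ) 1) : F.1 x ∈ Icc (0 : ℝ) 1 := by
  have h1 := F.map_add_one 0
  rw [zero_add, hF, zero_add] at h1
  have h2 := F.strictMono.monotone hx.1
  have h3 := F.strictMono.monotone hx.2
  rw [hF] at h2
  rw [h1] at h3
  exact ⟨h2, h3⟩

/-- The restriction to the unit interval of a homeomorphism fixing the origin. -/
def restrictHomeo (F : ACZLoc) (hF : F.1 0 = 0) : unitInterval ≃ₜ unitInterval where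
  toFun x := ⟨F.1 x, apply_mem_Icc_of_fixes_zero hF x.2⟩
  invFun x := ⟨F⁻¹.1 x, apply_mem_Icc_of_fixes_zero (F := F⁻¹)
    (by conv_lhs => rw [← hF, ACZLoc.inv_apply_self]) x.2⟩
  left_inv x := Subtype.ext (F.inv_apply_self x)
  right_inv x := Subtype.ext (F.apply_inv_self x)
  continuous_toFun := by
    exact (F.1.continuous.comp continuous_subtype_val).subtype_mk _
  continuous_invFun := by
    exact (F⁻¹.1.continuous.comp continuous_subtype_val).subtype_mk _

theorem exists_toACZLocHom_eq {F : ACZLoc} (hF : F.1 0 = 0) : ∃ f : ACI, toACZLocHom f = F := by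
  let r := restrictHomeo F hF
  have hmono : StrictMono r := fun x y hxy => F.strictMono hxy
  have e1 : EqOn F.1 (extendI r) (uIcc 0 1) := fun x hx => by
    rw [uIcc_of_le zero_le_one] at hx
    rw [extendI_apply r hx]
    rfl
  have e2 : EqOn F⁻¹.1 (extendI r⁻¹) (uIcc 0 1) := fun x hx => by
    rw [uIcc_of_le zero_le_one] at hx
    rw [extendI_apply r⁻¹ hx]
    rfl
  refine ⟨⟨r, hmono, (F.locallyAC 0 1).congr_of_eqOn e1, (F⁻¹.locallyAC 0 1).congr_of_eqOn e2⟩,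
    Subtype.ext (Homeomorph.ext fun x => ?_)⟩
  have h1 := F.map_add_intCast (Int.fract x) ⌊x⌋
  rw [Int.fract_add_floor] at h1
  rw [toACZLocHom_apply, h1, periodicExt, add_comm, extendI_apply r
    ⟨Int.fract_nonneg x, (Int.fract_lt_one x).le⟩]
  rfl

theorem range_toACZLocHom : range toACZLocHom = {F : ACZLoc | F.1 0 = 0} := by
  ext F
  constructor
  · rintro ⟨f, rfl⟩
    exact toACZLocHom_apply_zero f
  · exact exists_toACZLocHom_eq

theorem injective_toACZLocHom : Function.Injective toACZLocHom := by
  intro f g hfg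
  refine Subtype.ext (Homeomorph.ext fun x => Subtype.ext ?_)
  have h1 := toACZLocHom_apply f x
  have h2 := toACZLocHom_apply g x
  rw [← periodicExt_eqOn f.2.1 x.2, extendI_apply f.1 x.2] at h1
  rw [← periodicExt_eqOn g.2.1 x.2, extendI_apply g.1 x.2] at h2
  rw [hfg] at h1
  exact h1.symm.trans h2

/-- On maps fixing 0 the uniform part of the metric is dominated by the derivative part, so the
embedding is bi-Lipschitz onto its range, and fixing 0 is a closed condition. -/
theorem isClosedEmbedding_toACZLocHom : IsClosedEmbedding toACZLocHom := by
  refine ⟨⟨isInducing_toACZLocHom, injective_toACZLocHom⟩, ?_⟩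
  rw [range_toACZLocHom]
  exact isClosed_eq (ACZLoc.continuous_apply 0) continuous_const

theorem isPolishGroup : IsPolishGroup ACI := by
  have := isPolishGroup_acZLoc.2
  exact ⟨isInducing_toACZLocHom.topologicalGroup,
    isClosedEmbedding_toACZLocHom.polishSpace⟩

theorem isCompatibleNorm : IsCompatibleNorm fun f : ACI => dist f 1 :=
  isCompatibleNorm_dist_one fun f g h => by
    rw [dist_eq_derivDist, dist_eq_derivDist, map_mul, map_mul, ACZLoc.derivDist_mul_right]

theorem interp_apply_zero {F : ACZLoc} (hF : F.1 0 = 0) (t : ℝ) :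
    (ACZLoc.interp F t).1 0 = 0 := by
  unfold ACZLoc.interp
  split_ifs with h
  · change ACZLoc.interpFun F t 0 = 0
    simp [ACZLoc.interpFun, hF]
  · exact hF

/-- The linear path from the identity to a map fixing 0 consists of maps fixing 0, so the
factorisation takes place in the subgroup, with displacement bound 0 for all elements at once. -/
theorem isCoarselyBoundedGroup : IsCoarselyBoundedGroup ACI := by
  refine isCoarselyBounded_of_forall_subset_pow fun V hV => ?_
  obtain ⟨ε, hε, hs⟩ := Metric.mem_nhds_iff.1 hV
  obtain ⟨n, hn, h⟩ := ACZLoc.exists_nat_dist_interp_lt 0 hε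
  refine ⟨n, fun f _ => ?_⟩
  have hf := toACZLocHom_apply_zero f
  choose γ hγ using fun i : ℕ =>
    exists_toACZLocHom_eq (interp_apply_zero hf (i / n : ℝ))
  have hn0 : (n : ℝ) ≠ 0 := by exact_mod_cast hn.ne'
  have h0 : γ 0 = 1 := injective_toACZLocHom (by
    rw [hγ, map_one, Nat.cast_zero, zero_div, ACZLoc.interp_zero])
  have h1 : γ n = f := injective_toACZLocHom (by rw [hγ, div_self hn0, ACZLoc.interp_one])
  rw [← h1]
  refine mem_pow_of_path h0 n fun i hi => hs ?_
  refine (dist_le_dist _ _).trans_lt ?_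
  rw [map_mul, map_inv, map_one, hγ, hγ]
  exact h _ (by rw [hf, abs_zero]) i hi

end ACI

/-! ### The group of the circle as a quotient of the group of the line -/

theorem continuous_circleCover : Continuous circleCover := by
  unfold circleCover
  fun_prop

theorem isOpenMap_circleCover : IsOpenMap circleCover := by
  have h : (2 * Real.pi) ≠ 0 := by positivity
  exact Circle.isCoveringMap_exp.isOpenMap.comp (Homeomorph.mulLeft₀ _ h).isOpenMap

theorem surjective_circleCover : Function.Surjective circleCover := fun z =>
  (circleCover_exists z).imp fun _ h => h.2

theorem circleCover_add_intCast (x : ℝ) (n : ℤ) : circleCover (x + n) = circleCover x :=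
  circleCover_eq_iff.2 ⟨n, rfl⟩

theorem isQuotientMap_circleCover : IsQuotientMap circleCover :=
  isOpenMap_circleCover.isQuotientMap continuous_circleCover surjective_circleCover

theorem circleDist_circleCover_le (x y : ℝ) :
    circleDist (circleCover x) (circleCover y) ≤ |x - y| :=
  csInf_le (circleDist_bddBelow _ _) ⟨x, y, rfl, rfl, rfl⟩

theorem exists_circleCover_eq_of_circleDist_lt {x r : ℝ} {z : Circle}
    (h : circleDist (circleCover x) z < r) : ∃ y, circleCover y = z ∧ |x - y| < r := by
  obtain ⟨_, ⟨s, t, hs, ht, rfl⟩, hr⟩ := exists_lt_of_csInf_lt (circleDist_nonempty _ _) h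
  obtain ⟨m, rfl⟩ := circleCover_eq_iff.1 hs
  refine ⟨t - m, ?_, ?_⟩
  · rw [← ht]
    exact circleCover_eq_iff.2 ⟨-m, by push_cast; ring⟩
  · rwa [← sub_add, sub_add_eq_add_sub]

namespace ACCircle

/-- The self-map of the circle covered by `F`. -/
def descend (F : ACZLoc) (z : Circle) : Circle :=
  circleCover (F.1 (circleCover_exists z).choose)

theorem descend_circleCover (F : ACZLoc) (x : ℝ) :
    descend F (circleCover x) = circleCover (F.1 x) := by
  obtain ⟨m, hm⟩ := circleCover_eq_iff.1 (circleCover_exists (circleCover x)).choose_spec.2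
  rw [descend, hm, F.map_add_intCast, circleCover_add_intCast]

theorem continuous_descend (F : ACZLoc) : Continuous (descend F) := by
  rw [isQuotientMap_circleCover.continuous_iff]
  exact (continuous_circleCover.comp F.1.continuous).congr fun x => (descend_circleCover F x).symm

theorem descend_inv_descend (F : ACZLoc) (z : Circle) : descend F⁻¹ (descend F z) = z := by
  obtain ⟨x, rfl⟩ := surjective_circleCover z
  rw [descend_circleCover, descend_circleCover, F.inv_apply_self]

/-- The homeomorphism of the circle covered by `F`. -/
def descendHomeo (F : ACZLoc) : Circle ≃ₜ Circle where
  toFun := descend F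
  invFun := descend F⁻¹
  left_inv := descend_inv_descend F
  right_inv z := by
    have := descend_inv_descend F⁻¹ z
    rwa [inv_inv] at this
  continuous_toFun := continuous_descend F
  continuous_invFun := continuous_descend F⁻¹

theorem absolutelyContinuousCircle_of_covers {f : Circle ≃ₜ Circle} {F : ℝ ≃ₜ ℝ}
    (hF : ∀ x : ℝ, circleCover (F x) = f (circleCover x))
    (hac : LocallyAbsolutelyContinuous F) : AbsolutelyContinuousCircle f :=
  ⟨_, isCircleLift_sub_floor hF, fun a b => (hac a b).add
    ((LipschitzWith.const _).lipschitzOnWith).absolutelyContinuousOnInterval⟩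

theorem descendHomeo_mem (F : ACZLoc) : descendHomeo F ∈ acCircleSubgroup := by
  refine ⟨⟨_, isCircleLift_sub_floor (F := F.1) fun x => (descend_circleCover F x).symm, ?_⟩,
    absolutelyContinuousCircle_of_covers (fun x => (descend_circleCover F x).symm) F.locallyAC,
    absolutelyContinuousCircle_of_covers (f := (descendHomeo F)⁻¹)
      (fun x => (descend_circleCover F⁻¹ x).symm) F⁻¹.locallyAC⟩
  intro x y hxy
  simpa using F.strictMono hxy

/-- The projection of `AC_ℤ^loc(ℝ)` onto `AC₊(S¹)`. -/
def proj : ACZLoc →* ACCircle :=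
  MonoidHom.mk' (fun F => ⟨descendHomeo F, descendHomeo_mem F⟩) fun F G =>
    Subtype.ext (Homeomorph.ext fun z => by
      obtain ⟨x, rfl⟩ := surjective_circleCover z
      change descend (F * G) _ = descend F (descend G _)
      simp only [descend_circleCover, ACZLoc.mul_apply])

theorem proj_circleCover (F : ACZLoc) (x : ℝ) :
    (proj F).1 (circleCover x) = circleCover (F.1 x) :=
  descend_circleCover F x

theorem proj_eq_iff {F : ACZLoc} {a : ACCircle} :
    proj F = a ↔ ∀ x, circleCover (F.1 x) = a.1 (circleCover x) := by
  constructor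
  · rintro rfl x
    exact (proj_circleCover F x).symm
  · intro h
    refine Subtype.ext (Homeomorph.ext fun z => ?_)
    obtain ⟨x, rfl⟩ := surjective_circleCover z
    rw [proj_circleCover, h]

theorem proj_integerTranslation_mul (n : Multiplicative ℤ) (F : ACZLoc) :
    proj (integerTranslation n * F) = proj F := by
  rw [proj_eq_iff]
  intro x
  rw [proj_circleCover, ACZLoc.mul_apply, ACZLoc.integerTranslation_apply,
    circleCover_add_intCast]

/-- The lift gains a positive integer over a unit interval. If it gained 2 or more, some point
strictly between `x` and `x + 1` would have the same image on the circle as `x`, against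
injectivity. -/
theorem circleLift_map_add_one (a : ACCircle) (x : ℝ) :
    circleLift a (x + 1) = circleLift a x + 1 := by
  have hcov := (circleLift_spec a).2
  have hmono : StrictMono (circleLift a) := a.2.1.choose_spec.2
  have hx : circleCover (x + 1) = circleCover x := by
    simpa using circleCover_add_intCast x 1
  have h1 : circleCover (circleLift a (x + 1)) = circleCover (circleLift a x) := by
    rw [hcov, hcov, hx]
  obtain ⟨m, hm⟩ := circleCover_eq_iff.1 h1
  have hm0 : (0 : ℝ) < m := by
    have := hmono (show x < x + 1 by linarith)
    linarith
  have hm1 : 1 ≤ m := by exact_mod_cast hm0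
  rcases hm1.eq_or_lt with rfl | hm2
  · simpa using hm
  exfalso
  have hm2' : (1 : ℝ) < m := by exact_mod_cast hm2
  obtain ⟨y, hy⟩ := (circleLift a).surjective (circleLift a x + 1)
  have hxy : x < y := by
    rw [← hmono.lt_iff_lt, hy]
    linarith
  have hyx : y < x + 1 := by
    rw [← hmono.lt_iff_lt, hy, hm]
    linarith
  have h2 : circleCover (circleLift a y) = circleCover (circleLift a x) := by
    rw [hy]
    simpa using circleCover_add_intCast (circleLift a x) 1
  rw [hcov, hcov] at h2
  obtain ⟨k, rfl⟩ := circleCover_eq_iff.1 (a.1.injective h2)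
  have hk0 : (0 : ℝ) < k := by linarith
  have hk1 : (k : ℝ) < 1 := by linarith
  have : (0 : ℤ) < k := by exact_mod_cast hk0
  have : k < (1 : ℤ) := by exact_mod_cast hk1
  omega

/-- The inverse of the lift and the lift of the inverse differ by an integer constant. -/
theorem locallyAC_circleLift_inv (a : ACCircle) :
    LocallyAbsolutelyContinuous ((circleLift a)⁻¹ : ℝ ≃ₜ ℝ) := by
  obtain ⟨G, hG, hGac⟩ := a.2.2.2
  have h1 : ∀ x : ℝ, circleCover ((circleLift a)⁻¹ x) = (a.1)⁻¹ (circleCover x) := by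
    intro x
    apply a.1.injective
    rw [← (circleLift_spec a).2]
    simp
  have h2 := (isCircleLift_sub_floor h1).unique hG
  have h3 : ((circleLift a)⁻¹ : ℝ ≃ₜ ℝ) = fun x => G x + ⌊(circleLift a)⁻¹ 0⌋ := by
    funext x
    rw [← h2]
    simp
  rw [h3]
  exact fun u v => (hGac u v).add
    ((LipschitzWith.const _).lipschitzOnWith).absolutelyContinuousOnInterval

theorem surjective_proj : Function.Surjective proj := fun a =>
  ⟨⟨circleLift a, map_add_intCast_of_map_add_one (circleLift_map_add_one a),
    circleLift_locallyAbsolutelyContinuous a, locallyAC_circleLift_inv a⟩,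
    proj_eq_iff.2 (circleLift_spec a).2⟩

theorem exists_proj_eq_apply_zero {a : ACCircle} {y : ℝ}
    (h : circleCover y = a.1 (circleCover 0)) : ∃ F : ACZLoc, proj F = a ∧ F.1 0 = y := by
  obtain ⟨F, rfl⟩ := surjective_proj a
  rw [proj_circleCover] at h
  obtain ⟨m, hm⟩ := circleCover_eq_iff.1 h
  refine ⟨integerTranslation (Multiplicative.ofAdd m) * F, proj_integerTranslation_mul _ _, ?_⟩
  rw [ACZLoc.mul_apply, ACZLoc.integerTranslation_apply, hm]
  simp

theorem deriv_circleLift_proj (F : ACZLoc) : deriv (circleLift (proj F)) = deriv F.1 := by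
  have h := (circleLift_spec (proj F)).unique
    (isCircleLift_sub_floor fun x => (proj_circleCover F x).symm)
  funext x
  have h1 : (circleLift (proj F) : ℝ → ℝ) = fun x => F.1 x + -(⌊F.1 0⌋ : ℝ) := by
    rw [h]
    rfl
  rw [h1, deriv_add_const]

theorem derivDist_circleLift_proj (F G : ACZLoc) :
    derivDist (circleLift (proj F)) (circleLift (proj G)) = derivDist F.1 G.1 := by
  simp only [derivDist, deriv_circleLift_proj]

theorem dist_proj (F G : ACZLoc) :
    dist (proj F) (proj G) = supDistCircle (proj F).1 (proj G).1 + derivDist F.1 G.1 := by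
  rw [← derivDist_circleLift_proj]
  rfl

theorem supDistCircle_proj_le (F G : ACZLoc) :
    supDistCircle (proj F).1 (proj G).1 ≤ supDistI F.1 G.1 := by
  refine ciSup_le fun z => ?_
  obtain ⟨x, rfl⟩ := surjective_circleCover z
  rw [proj_circleCover, proj_circleCover]
  exact (circleDist_circleCover_le _ _).trans (ACZLoc.abs_sub_le_supDistI F G x)

theorem dist_proj_le (F G : ACZLoc) : dist (proj F) (proj G) ≤ dist F G := by
  rw [dist_proj, ACZLoc.dist_def]
  linarith [supDistCircle_proj_le F G]

theorem supDistCircle_nonneg (f g : Circle ≃ₜ Circle) : 0 ≤ supDistCircle f g :=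
  (circleDist_nonneg _ _).trans (le_ciSup (supDistCircle_bddAbove f g) 1)

theorem derivDist_le_dist (F G : ACZLoc) : derivDist F.1 G.1 ≤ dist (proj F) (proj G) := by
  rw [dist_proj]
  linarith [supDistCircle_nonneg (proj F).1 (proj G).1]

theorem circleDist_le_dist (a b : ACCircle) (z : Circle) :
    circleDist (a.1 z) (b.1 z) ≤ dist a b := by
  have h1 := le_ciSup (supDistCircle_bddAbove a.1 b.1) z
  have h2 := derivDist_nonneg (circleLift a) (circleLift b)
  exact h1.trans (le_add_of_nonneg_right h2)

theorem continuous_proj : Continuous proj :=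
  (LipschitzWith.of_dist_le_mul (K := 1) fun F G => by
    rw [NNReal.coe_one, one_mul]
    exact dist_proj_le F G).continuous

/-- A circle map near `proj F` has a lift `G` with `G(0)` near `F(0)`, and the derivative distance
does not depend on the lifts. The third of `ε` is spent once on the value at 0 and twice on the
derivatives. -/
theorem isOpenMap_proj : IsOpenMap proj := by
  rw [isOpenMap_iff_nhds_le]
  intro F s hs
  obtain ⟨ε, hε, hs'⟩ := Metric.mem_nhds_iff.1 (mem_map.1 hs)
  refine Metric.mem_nhds_iff.2 ⟨ε / 3, by positivity, fun b hb => ?_⟩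
  rw [Metric.mem_ball, dist_comm] at hb
  have h1 := (circleDist_le_dist (proj F) b (circleCover 0)).trans_lt hb
  rw [proj_circleCover] at h1
  obtain ⟨y, hy, hFy⟩ := exists_circleCover_eq_of_circleDist_lt h1
  obtain ⟨G, rfl, rfl⟩ := exists_proj_eq_apply_zero hy
  refine hs' ?_
  rw [Metric.mem_ball, dist_comm]
  have h2 := ACZLoc.dist_le F G
  have h3 := (derivDist_le_dist F G).trans_lt hb
  linarith

theorem isOpenQuotientMap_proj : IsOpenQuotientMap proj :=
  ⟨surjective_proj, continuous_proj, isOpenMap_proj⟩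

instance : IsTopologicalGroup ACCircle where
  continuous_mul := by
    rw [(isOpenQuotientMap_proj.prodMap isOpenQuotientMap_proj).isQuotientMap.continuous_iff]
    refine (continuous_proj.comp continuous_mul).congr fun p => ?_
    exact map_mul proj p.1 p.2
  continuous_inv := by
    rw [isOpenQuotientMap_proj.isQuotientMap.continuous_iff]
    exact (continuous_proj.comp continuous_inv).congr fun p => map_inv proj p

theorem dist_mul_right (a b c : ACCircle) : dist (a * c) (b * c) = dist a b := by
  obtain ⟨F, rfl⟩ := surjective_proj a
  obtain ⟨G, rfl⟩ := surjective_proj b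
  obtain ⟨H, rfl⟩ := surjective_proj c
  rw [← map_mul, ← map_mul, dist_proj, dist_proj, ACZLoc.derivDist_mul_right, map_mul, map_mul]
  congr 1
  exact (proj H).1.surjective.iSup_comp
    (g := fun z => circleDist ((proj F).1 z) ((proj G).1 z))

theorem isCompatibleNorm : IsCompatibleNorm fun a : ACCircle => dist a 1 :=
  isCompatibleNorm_dist_one dist_mul_right

/-- Every element has a lift displacing the origin by at most `1 / 2`, so the group is the image of
a coarsely bounded set. -/
theorem isCoarselyBoundedGroup : IsCoarselyBoundedGroup ACCircle := by
  refine isCoarselyBounded_of_forall_subset_pow fun V hV => ?_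
  have hV' : proj ⁻¹' V ∈ 𝓝 (1 : ACZLoc) :=
    continuous_proj.continuousAt.preimage_mem_nhds (by rwa [map_one])
  obtain ⟨k, hk⟩ := ACZLoc.exists_smallDisplacement_subset_pow hV'
  refine ⟨k, fun a _ => ?_⟩
  obtain ⟨y, hy, hya⟩ := circleCover_exists (a.1 (circleCover 0))
  obtain ⟨F, rfl, rfl⟩ := exists_proj_eq_apply_zero hya
  have hF := hk (show F ∈ ACZLoc.smallDisplacement from hy.trans (by norm_num))
  refine pow_subset_pow_left (image_preimage_subset proj V) ?_
  rw [← Set.image_pow]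
  exact mem_image_of_mem _ hF

/-- The derivative of the lifts of `a` on the unit interval. -/
def derivL1 (a : ACCircle) : UnitL1 := (Function.surjInv surjective_proj a).derivL1

theorem derivL1_proj (F : ACZLoc) : derivL1 (proj F) = F.derivL1 := by
  refine dist_le_zero.1 ?_
  rw [derivL1, ACZLoc.dist_derivL1]
  refine (derivDist_le_dist _ _).trans_eq ?_
  rw [Function.surjInv_eq surjective_proj, dist_self]

theorem continuous_derivL1 : Continuous derivL1 := by
  rw [isOpenQuotientMap_proj.isQuotientMap.continuous_iff]
  exact ACZLoc.continuous_derivL1.congr fun F => (derivL1_proj F).symm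

theorem continuous_apply_base : Continuous fun a : ACCircle => a.1 (circleCover 0) := by
  rw [isOpenQuotientMap_proj.isQuotientMap.continuous_iff]
  exact (continuous_circleCover.comp (ACZLoc.continuous_apply 0)).congr fun F =>
    (proj_circleCover F 0).symm

theorem isInducing_apply_base_derivL1 :
    IsInducing fun a : ACCircle => ((a.1 (circleCover 0), derivL1 a) : Circle × UnitL1) := by
  refine isInducing_iff_nhds.2 fun a => le_antisymm ?_ ?_
  · exact ((continuous_apply_base.prodMk continuous_derivL1).tendsto a).le_comap
  · obtain ⟨F, rfl⟩ := surjective_proj a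
    have h := tendsto_comap
      (f := fun a : ACCircle => ((a.1 (circleCover 0), derivL1 a) : Circle × UnitL1))
      (x := 𝓝 ((proj F).1 (circleCover 0), derivL1 (proj F)))
    have h1 := (continuous_fst.tendsto ((proj F).1 (circleCover 0), derivL1 (proj F))).comp h
    have h2 := (continuous_snd.tendsto ((proj F).1 (circleCover 0), derivL1 (proj F))).comp h
    refine tendsto_id'.1 (Metric.tendsto_nhds.2 fun ε hε => ?_)
    -- Openness of the covering map lets the value on the circle be lifted near `F(0)`.
    have h3 : circleCover '' Metric.ball (F.1 0) (ε / 3) ∈ 𝓝 ((proj F).1 (circleCover 0)) := by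
      rw [proj_circleCover]
      exact (isOpenMap_circleCover.image_mem_nhds (Metric.ball_mem_nhds _ (by positivity)))
    filter_upwards [h1 h3, h2 (Metric.ball_mem_nhds _ (show 0 < ε / 3 by positivity))] with b hb hb'
    obtain ⟨y, hy, hyb⟩ := hb
    obtain ⟨G, rfl, rfl⟩ := exists_proj_eq_apply_zero hyb
    have h4 : dist (derivL1 (proj G)) (derivL1 (proj F)) < ε / 3 := hb'
    rw [derivL1_proj, derivL1_proj, ACZLoc.dist_derivL1] at h4
    have h5 : |G.1 0 - F.1 0| < ε / 3 := hy
    have h6 := ACZLoc.dist_le G F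
    have h7 := dist_proj_le G F
    simp only [id]
    linarith

/-- The coordinates that exhibit the group as a closed subset of a Polish space. -/
def coords (a : ACCircle) : (Circle × UnitL1) × UnitL1 :=
  ((a.1 (circleCover 0), derivL1 a), derivL1 a⁻¹)

theorem continuous_coords : Continuous coords :=
  (continuous_apply_base.prodMk continuous_derivL1).prodMk (continuous_derivL1.comp continuous_inv)

theorem injective_coords : Function.Injective coords := by
  intro a b h
  obtain ⟨y, -, hy⟩ := circleCover_exists (a.1 (circleCover 0))
  have h1 := congrArg Prod.fst h
  have h2 : a.1 (circleCover 0) = b.1 (circleCover 0) := congrArg Prod.fst h1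
  have h3 : derivL1 a = derivL1 b := congrArg Prod.snd h1
  obtain ⟨G, rfl, hG⟩ := exists_proj_eq_apply_zero (hy.trans h2)
  obtain ⟨F, rfl, hF⟩ := exists_proj_eq_apply_zero hy
  rw [derivL1_proj, derivL1_proj] at h3
  rw [ACZLoc.ext_of_derivL1 (hF.trans hG.symm) h3]

/-- Lifts with `|F n (0)| ≤ 1 / 2` also have bounded `(F n)⁻¹ (0)`. Compactness gives a subsequence
along which both converge, and the limit found in `ACZLoc` is projected; this is why no base point
of the inverse is recorded in `coords`. -/
theorem isClosed_range_coords : IsClosed (range coords) := by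
  refine isClosed_of_closure_subset fun p hp => ?_
  obtain ⟨x, hx, hxp⟩ := mem_closure_iff_seq_limit.1 hp
  choose a ha using hx
  obtain rfl : (fun n => coords (a n)) = x := funext ha
  obtain ⟨⟨z, φ⟩, ψ⟩ := p
  rw [nhds_prod_eq, nhds_prod_eq] at hxp
  have h1 := tendsto_prod_iff'.1 hxp
  have h2 := tendsto_prod_iff'.1 h1.1
  choose c hc hca using fun n => circleCover_exists ((a n).1 (circleCover 0))
  choose F hFa hFc using fun n => exists_proj_eq_apply_zero (hca n)
  -- Equivariance gives `F n (-1) ≤ 0 ≤ F n 1`, so the zero of `F n` lies between -1 and 1.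
  have hb : ∀ n, |(F n)⁻¹.1 0| ≤ 1 := by
    intro n
    have h3 := abs_le.1 (hc n)
    have h4 := (F n).map_add_one 0
    have h5 := (F n).map_add_one (-1)
    rw [neg_add_cancel] at h5
    rw [zero_add] at h4
    have h6 := hFc n
    rw [abs_le]
    constructor
    · rw [← (F n).strictMono.le_iff_le, ACZLoc.apply_inv_self]
      linarith
    · rw [← (F n).strictMono.le_iff_le, ACZLoc.apply_inv_self]
      linarith
  have hbdd : ∀ n, ((F n).1 0, (F n)⁻¹.1 0) ∈ Metric.closedBall ((0 : ℝ), (0 : ℝ)) 1 := by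
    intro n
    rw [← closedBall_prod_same]
    refine ⟨?_, ?_⟩
    · simpa [hFc n] using (hc n).trans (by norm_num)
    · simpa using hb n
  obtain ⟨⟨c', b'⟩, -, θ, hθ, hlim⟩ := tendsto_subseq_of_bounded Metric.isBounded_closedBall hbdd
  rw [nhds_prod_eq] at hlim
  have h3 := tendsto_prod_iff'.1 hlim
  have hD : ∀ n, (F n).derivL1 = derivL1 (a n) := fun n => by rw [← hFa, derivL1_proj]
  have hD' : ∀ n, (F n)⁻¹.derivL1 = derivL1 (a n)⁻¹ := fun n => by
    rw [← hFa, ← map_inv, derivL1_proj]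
  obtain ⟨f, hf0, -, rfl, rfl⟩ := ACZLoc.exists_eq_of_tendsto (F := fun n => F (θ n)) h3.1 h3.2
    ((h2.2.comp hθ.tendsto_atTop).congr fun n => (hD (θ n)).symm)
    ((h1.2.comp hθ.tendsto_atTop).congr fun n => (hD' (θ n)).symm)
  have hz : circleCover c' = z := by
    refine tendsto_nhds_unique ((continuous_circleCover.tendsto c').comp h3.1)
      ((h2.1.comp hθ.tendsto_atTop).congr fun n => ?_)
    simp only [Function.comp_apply, coords]
    rw [← hca, hFc]
  refine ⟨proj f, ?_⟩
  rw [coords, derivL1_proj, ← map_inv, derivL1_proj, proj_circleCover, hf0, hz]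

theorem isPolishGroup : IsPolishGroup ACCircle := by
  have := polishSpace_unitL1
  have h : IsClosedEmbedding coords :=
    ⟨⟨IsInducing.of_comp (g := Prod.fst) continuous_coords continuous_fst
      isInducing_apply_base_derivL1, injective_coords⟩, isClosed_range_coords⟩
  exact ⟨inferInstance, h.polishSpace⟩

end ACCircle

end

theorem theorem1p1 :
    (IsPolishGroup ACI ∧ IsGeneratedByCoarselyBounded ACI ∧ HasWellDefinedQIType ACI) ∧
    (IsPolishGroup ACCircle ∧ IsGeneratedByCoarselyBounded ACCircle ∧
      HasWellDefinedQIType ACCircle) ∧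
    (IsPolishGroup ACZLoc ∧ IsGeneratedByCoarselyBounded ACZLoc ∧ HasWellDefinedQIType ACZLoc) ∧
    (IsCoarselyBoundedGroup ACI ∧ HasTrivialQIType ACI) ∧
    (IsCoarselyBoundedGroup ACCircle ∧ HasTrivialQIType ACCircle) ∧
    IsPolishQuasiIsometry integerTranslation :=
  ⟨⟨ACI.isPolishGroup,
      ACI.isCoarselyBoundedGroup.isCoarseGeneratingSet_univ.isGeneratedByCoarselyBounded,
      ACI.isPolishGroup.hasWellDefinedQIType ACI.isCompatibleNorm
        ACI.isCoarselyBoundedGroup.isCoarseGeneratingSet_univ⟩,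
    ⟨ACCircle.isPolishGroup,
      ACCircle.isCoarselyBoundedGroup.isCoarseGeneratingSet_univ.isGeneratedByCoarselyBounded,
      ACCircle.isPolishGroup.hasWellDefinedQIType ACCircle.isCompatibleNorm
        ACCircle.isCoarselyBoundedGroup.isCoarseGeneratingSet_univ⟩,
    ⟨isPolishGroup_acZLoc,
      ACZLoc.isCoarseGeneratingSet_smallDisplacement.isGeneratedByCoarselyBounded,
      isPolishGroup_acZLoc.hasWellDefinedQIType ACZLoc.isCompatibleNorm
        ACZLoc.isCoarseGeneratingSet_smallDisplacement⟩,
    ⟨ACI.isCoarselyBoundedGroup,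
      ACI.isPolishGroup.hasTrivialQIType ACI.isCompatibleNorm ACI.isCoarselyBoundedGroup⟩,
    ⟨ACCircle.isCoarselyBoundedGroup,
      ACCircle.isPolishGroup.hasTrivialQIType ACCircle.isCompatibleNorm
        ACCircle.isCoarselyBoundedGroup⟩,
    ACZLoc.isPolishQuasiIsometry_integerTranslation⟩
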